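/- Let $n$ be a natural number. Write $\mathrm{Gr}(k,n)$ for the Grassmannian of $k$-dimensional subspaces of an $n$-dimensional space; its points are represented by $k\times n$ matrices of rank $k$ up to invertible row operations, and the Plücker coordinates are the maximal minors. Let $V(3,n)\subset \mathrm{Gr}(3,n)$ be the complex variety obtained as the Zariski closure of the image of the rational map $\mathrm{Gr}(2,n)\dashrightarrow \mathrm{Gr}(3,n)$ that sends each column $(a,b)^{T}$ of a $2\times n$ matrix to the column $(a^2,ab,b^2)^{T}$, and let $V=V(3,n)(\mathbb{R})\subset \mathrm{Gr}(3,n)(\mathbb{R})$ be its set of real points, with the analytic (Euclidean) topology. Let $\mathrm{Gr}_{\ge 0}$ (resp. $\mathrm{Gr}_{>0}$) be the set of points of $\mathrm{Gr}(3,n)(\mathbb{R})$ that have a representative all of whose Plücker coordinates are nonnegative (resp. positive), and put $V_{\ge 0}=V\cap \mathrm{Gr}_{\ge 0}$. Let $\operatorname{int}_V(V_{\ge 0})$ be the interior of $V_{\ge 0}$ in the space $V$, and let $\partial V_{\ge 0}=V_{\ge 0}\setminus \operatorname{int}_V(V_{\ge 0})$ be the analytic boundary. Then $$\partial V_{\ge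 0}=(\mathrm{Gr}_{\ge 0}\setminus \mathrm{Gr}_{>0})\cap V .$$ Moreover, $\operatorname{int}_V(V_{\ge 0})=V\cap \mathrm{Gr}_{>0}$, and $V_{\ge 0}$ is the closure of $V\cap \mathrm{Gr}_{>0}$ in the analytic topology of $\mathrm{Gr}(3,n)(\mathbb{R})$. -/

import Mathlib

namespace ABCT

/-- The maximal minor (Plücker coordinate) of a `k × n` matrix on the columns
`I 0 < I 1 < ⋯ < I (k - 1)`. -/
def minor {K : Type*} [CommRing K] {k n : ℕ} (M : Matrix (Fin k) (Fin n) K)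
    (I : Fin k ↪o Fin n) : K :=
  (M.submatrix id I).det

/-- The `k × n` matrices of rank `k`, i.e. those with a nonzero maximal minor. -/
def FullRank (K : Type*) [Field K] (k n : ℕ) : Type _ :=
  {M : Matrix (Fin k) (Fin n) K // ∃ I : Fin k ↪o Fin n, minor M I ≠ 0}

/-- Two matrices of rank `k` have the same row space iff they differ by an invertible matrix acting
on the left. -/
def rowSetoid (K : Type*) [Field K] (k n : ℕ) : Setoid (FullRank K k n) where
  r M N := ∃ g : GL (Fin k) K, N.1 = (g : Matrix (Fin k) (Fin k) K) * M.1
  iseqv :=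
    { refl := fun M => ⟨1, by simp⟩
      symm := by
        rintro M N ⟨g, h⟩
        refine ⟨g⁻¹, ?_⟩
        rw [h, ← Matrix.mul_assoc, ← Units.val_mul, inv_mul_cancel, Units.val_one, Matrix.one_mul]
      trans := by
        rintro M N P ⟨g, h⟩ ⟨g', h'⟩
        refine ⟨g' * g, ?_⟩
        rw [h', h, Units.val_mul, Matrix.mul_assoc] }

/-- The `K`-points of the Grassmannian `Gr(k,n)`: full rank `k × n` matrices modulo row
operations. -/
def Gr (K : Type*) [Field K] (k n : ℕ) : Type _ :=
  Quotient (rowSetoid K k n)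

/-- The point of the Grassmannian represented by a full rank matrix (its row space). -/
def Gr.mk {K : Type*} [Field K] {k n : ℕ} (M : FullRank K k n) : Gr K k n :=
  Quotient.mk (rowSetoid K k n) M

/-- Full rank real matrices, with the topology of a subspace of the space of all matrices. -/
instance (k n : ℕ) : TopologicalSpace (FullRank ℝ k n) :=
  inferInstanceAs (TopologicalSpace
    {M : Matrix (Fin k) (Fin n) ℝ // ∃ I : Fin k ↪o Fin n, minor M I ≠ 0})

/-- The analytic (Euclidean) topology on the real points of the Grassmannian: the quotient
topology. -/
instance (k n : ℕ) : TopologicalSpace (Gr ℝ k n) :=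
  inferInstanceAs (TopologicalSpace (Quotient (rowSetoid ℝ k n)))

/-- The totally nonnegative Grassmannian: Plücker coordinates are homogeneous coordinates, so the
condition is that they are all nonnegative for some choice of representative. -/
def GrNonneg (k n : ℕ) : Set (Gr ℝ k n) :=
  {x | ∃ M : FullRank ℝ k n, Gr.mk M = x ∧ ∀ I, 0 ≤ minor M.1 I}

/-- The positive Grassmannian. -/
def GrPos (k n : ℕ) : Set (Gr ℝ k n) :=
  {x | ∃ M : FullRank ℝ k n, Gr.mk M = x ∧ ∀ I, 0 < minor M.1 I}

/-- A polynomial in the Plücker coordinates vanishes at a point of the Grassmannian. -/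
def VanishesAt {K : Type*} [Field K] {k n : ℕ} (F : MvPolynomial (Fin k ↪o Fin n) K)
    (x : Gr K k n) : Prop :=
  ∀ M : FullRank K k n, Gr.mk M = x → MvPolynomial.eval (minor M.1) F = 0

/-- The Zariski closure of a set of points of the Grassmannian, in its Plücker embedding: the common
zeros of all homogeneous polynomials in the Plücker coordinates that vanish on the set. -/
def zariskiClosure {K : Type*} [Field K] {k n : ℕ} (S : Set (Gr K k n)) : Set (Gr K k n) :=
  {x | ∀ (d : ℕ) (F : MvPolynomial (Fin k ↪o Fin n) K), F.IsHomogeneous d →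
    (∀ y ∈ S, VanishesAt F y) → VanishesAt F x}

/-- The Veronese map applied to every column: `(a, b)` is sent to
`(a ^ (k-1), a ^ (k-2) * b, …, b ^ (k-1))`. -/
def veronese {K : Type*} [Field K] (k : ℕ) {n : ℕ} (A : Matrix (Fin 2) (Fin n) K) :
    Matrix (Fin k) (Fin n) K :=
  Matrix.of fun i j => A 0 j ^ (k - 1 - (i : ℕ)) * A 1 j ^ (i : ℕ)

/-- The image of the rational map `Gr(2,n) ⇢ Gr(k,n)` induced by the Veronese map (the map is
defined at the row space of `A` when the image matrix has full rank). -/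
def veroneseImage (K : Type*) [Field K] (k n : ℕ) : Set (Gr K k n) :=
  {x | ∃ (A : FullRank K 2 n) (M : FullRank K k n), M.1 = veronese k A.1 ∧ Gr.mk M = x}

/-- The (complex points of the) ABCT variety `V(k,n)`. -/
def V (k n : ℕ) : Set (Gr ℂ k n) :=
  zariskiClosure (veroneseImage ℂ k n)

theorem minor_map {K L : Type*} [CommRing K] [CommRing L] (f : K →+* L) {k n : ℕ}
    (M : Matrix (Fin k) (Fin n) K) (I : Fin k ↪o Fin n) :
    minor (M.map f) I = f (minor M I) := by
  simp only [minor, RingHom.map_det]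
  rfl

/-- A real full rank matrix, viewed as a complex one. -/
noncomputable def FullRank.toComplex {k n : ℕ} (M : FullRank ℝ k n) : FullRank ℂ k n :=
  ⟨M.1.map Complex.ofRealHom, by
    obtain ⟨I, hI⟩ := M.2
    refine ⟨I, ?_⟩
    rw [minor_map]
    simpa using hI⟩

/-- The inclusion of the real points of the Grassmannian into its complex points. -/
noncomputable def Gr.toComplex {k n : ℕ} : Gr ℝ k n → Gr ℂ k n :=
  Quotient.map FullRank.toComplex (by
    rintro M N ⟨g, h⟩
    refine ⟨Matrix.GeneralLinearGroup.map Complex.ofRealHom g, ?_⟩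
    simp only [FullRank.toComplex, h, Matrix.map_mul]
    rfl)

/-- The real points of the ABCT variety, as a subset of the real Grassmannian. -/
def VReal (k n : ℕ) : Set (Gr ℝ k n) :=
  {x | x.toComplex ∈ V k n}

/-- The totally nonnegative part of the ABCT variety. -/
def VNonneg (k n : ℕ) : Set (Gr ℝ k n) :=
  VReal k n ∩ GrNonneg k n

/-- The interior of `S ∩ Y` in the subspace `Y` of `X`, as a subset of `X`. -/
def interiorIn {X : Type*} [TopologicalSpace X] (Y S : Set X) : Set X :=
  Subtype.val '' interior (Subtype.val ⁻¹' S : Set Y)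

/-- The analytic boundary of `S` inside `Y`: the points of `S` that are not in the interior of `S`
relative to `Y`. -/
def boundaryIn {X : Type*} [TopologicalSpace X] (Y S : Set X) : Set X :=
  S \ interiorIn Y S

end ABCT

namespace ABCT

open Filter Topology

/-! A point of the real Grassmannian is read as a configuration of `n` column vectors in ℝ³. The
variety is bracketed between two conditions. Every real point of it satisfies the
six-points-on-a-conic relations (`sixRel_of_mem_VReal`). Conversely, every full-rank configuration
on a nondegenerate conic `x z = y ^ 2`, up to a linear change, lies in it (`OnConic.mk_mem_VReal`),
and so do full-rank limits of such configurations, because the variety is closed. Since `GrPos` is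
open and `GrNonneg` is closed, two approximation statements remain.

Density (`mem_closure_posConic`): a nonnegative rank-three configuration with the six-point
relations is a limit of positive configurations on nondegenerate conics. If two vectors are
opposite, or three distinct directions are coplanar, or there are at most four directions, all
vectors lie on two planes and on the boundary of a wedge between them. The pair of planes is then
smoothed to a thin cone, with all minors kept nonnegative (`wedge_mem_closure`). Otherwise five
directions in general position determine a conic, and total nonnegativity forces its coefficients to
have equal signs, so that it becomes the standard one (`mem_closure_of_five`). On the standard conic
the 3 × 3 minors are Vandermonde products of 2 × 2 minors. After sign changes the 2 × n matrix is
totally nonnegative, and a totally positive matrix close to the identity makes it positive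
(`ver_mem_closure`).

Boundary (`mem_closure_negConic`): if some minor vanishes, the configuration is a limit of points of
the variety having a negative minor. A zero vector or two parallel vectors give a symmetry of the
configuration that reverses the minor of a nearby positive configuration. Three distinct coplanar
directions force a pair of planes, which is deformed in the direction that makes the minor negative.
Keeping another minor positive prevents a global sign change from restoring nonnegativity
(`mem_closure_diff`). -/

/-! ### Determinants and independence in ℝ³. -/

/-- The determinant of the matrix with columns `u`, `v`, `w`. -/
def det3 (u v w : Fin 3 → ℝ) : ℝ :=
  u 0 * (v 1 * w 2 - v 2 * w 1) - u 1 * (v 0 * w 2 - v 2 * w 0) + u 2 * (v 0 * w 1 - v 1 * w 0)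

theorem det3_rotate (u v w : Fin 3 → ℝ) : det3 v w u = det3 u v w := by
  unfold det3; ring

theorem det3_swap_right (u v w : Fin 3 → ℝ) : det3 u w v = -det3 u v w := by
  unfold det3; ring

theorem det3_swap_left (u v w : Fin 3 → ℝ) : det3 v u w = -det3 u v w := by
  unfold det3; ring

theorem det3_smul_left (c : ℝ) (u v w : Fin 3 → ℝ) : det3 (c • u) v w = c * det3 u v w := by
  simp only [det3, Pi.smul_apply, smul_eq_mul]; ring

theorem det3_smul_mid (c : ℝ) (u v w : Fin 3 → ℝ) : det3 u (c • v) w = c * det3 u v w := by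
  simp only [det3, Pi.smul_apply, smul_eq_mul]; ring

theorem det3_smul_right (c : ℝ) (u v w : Fin 3 → ℝ) : det3 u v (c • w) = c * det3 u v w := by
  simp only [det3, Pi.smul_apply, smul_eq_mul]; ring

@[simp] theorem det3_self_left (u w : Fin 3 → ℝ) : det3 u u w = 0 := by
  unfold det3; ring

@[simp] theorem det3_self_right (u w : Fin 3 → ℝ) : det3 u w w = 0 := by
  unfold det3; ring

@[simp] theorem det3_self_outer (u w : Fin 3 → ℝ) : det3 u w u = 0 := by
  unfold det3; ring

theorem det3_mulVec (h : Matrix (Fin 3) (Fin 3) ℝ) (u v w : Fin 3 → ℝ) :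
    det3 (h.mulVec u) (h.mulVec v) (h.mulVec w) = h.det * det3 u v w := by
  simp only [det3, Matrix.mulVec, dotProduct, Fin.sum_univ_three, Matrix.det_fin_three]; ring

theorem continuous_det3 {X : Type*} [TopologicalSpace X] {u v w : X → Fin 3 → ℝ}
    (hu : Continuous u) (hv : Continuous v) (hw : Continuous w) :
    Continuous fun x => det3 (u x) (v x) (w x) := by
  unfold det3; fun_prop

theorem tendsto_det3 {X : Type*} {l : Filter X} {u v w : X → Fin 3 → ℝ} {u₀ v₀ w₀ : Fin 3 → ℝ}
    (hu : Tendsto u l (𝓝 u₀)) (hv : Tendsto v l (𝓝 v₀)) (hw : Tendsto w l (𝓝 w₀)) :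
    Tendsto (fun x => det3 (u x) (v x) (w x)) l (𝓝 (det3 u₀ v₀ w₀)) := by
  have h := (continuous_det3 (X := (Fin 3 → ℝ) × (Fin 3 → ℝ) × (Fin 3 → ℝ))
    continuous_fst (continuous_fst.comp continuous_snd)
    (continuous_snd.comp continuous_snd)).tendsto (u₀, v₀, w₀)
  exact h.comp (hu.prodMk_nhds (hv.prodMk_nhds hw))

/-- A vector is determined by its coordinates in a basis, by Cramer's rule. -/
theorem det3_smul_eq (a b c v : Fin 3 → ℝ) :
    det3 a b c • v = det3 v b c • a + det3 a v c • b + det3 a b v • c := by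
  ext i
  simp only [Pi.smul_apply, Pi.add_apply, smul_eq_mul, det3]
  fin_cases i <;> simp <;> ring

/-- A vector is zero if its coordinates in some basis vanish. -/
theorem eq_zero_of_det3 {a b c v : Fin 3 → ℝ} (h : det3 a b c ≠ 0) (h1 : det3 v b c = 0)
    (h2 : det3 a v c = 0) (h3 : det3 a b v = 0) : v = 0 := by
  have := det3_smul_eq a b c v
  rw [h1, h2, h3] at this
  simpa [h] using this

/-- The Grassmann-Plücker relation for two planes through a common line. -/
theorem det3_pluecker (b a c l m : Fin 3 → ℝ) :
    det3 b c l * det3 a b m - det3 b c m * det3 a b l = det3 a b c * det3 b m l := by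
  unfold det3; ring

/-- Two vectors are linearly independent. -/
def Indep (u v : Fin 3 → ℝ) : Prop := ∃ t, det3 u v t ≠ 0

theorem Indep.symm {u v : Fin 3 → ℝ} (h : Indep u v) : Indep v u := by
  obtain ⟨t, ht⟩ := h
  exact ⟨t, by rw [det3_swap_left]; simpa using ht⟩

theorem Indep.ne_zero {u v : Fin 3 → ℝ} (h : Indep u v) : u ≠ 0 := by
  rintro rfl
  obtain ⟨t, ht⟩ := h
  simp [det3] at ht

theorem exists_smul_of_not_indep {u v : Fin 3 → ℝ} (hu : u ≠ 0) (h : ¬ Indep u v) :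
    ∃ c : ℝ, v = c • u := by
  simp only [Indep, not_exists, not_not] at h
  have h0 := h ![1, 0, 0]
  have h1 := h ![0, 1, 0]
  have h2 := h ![0, 0, 1]
  simp [det3] at h0 h1 h2
  by_contra hc
  push Not at hc
  apply hu
  ext i
  by_contra hi
  apply hc (v i / u i)
  simp only [Pi.zero_apply] at hi
  ext j
  simp only [Pi.smul_apply, smul_eq_mul]
  rw [div_mul_eq_mul_div, eq_div_iff hi]
  fin_cases i <;> fin_cases j <;> simp at * <;> linarith

/-- In a plane, two independent vectors are detected by any vector off the plane. -/
theorem Indep.det3_ne_zero {a b c l : Fin 3 → ℝ} (hbc : Indep b c) (habc : det3 a b c = 0)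
    (hl : det3 a b l ≠ 0) : det3 b c l ≠ 0 := by
  intro h0
  obtain ⟨t, ht⟩ := hbc
  apply ht
  have := det3_pluecker b a c l t
  rw [h0, habc] at this
  simp only [zero_mul, zero_sub, neg_eq_zero, mul_eq_zero] at this
  exact this.resolve_right hl

/-! ### Cyclic order and total nonnegativity. -/

/-- Cyclic order. -/
def Cyc {n : ℕ} (i j k : Fin n) : Prop :=
  (i < j ∧ j < k) ∨ (j < k ∧ k < i) ∨ (k < i ∧ i < j)

/-- All `3 × 3` minors are nonnegative. -/
def TNonneg {n : ℕ} (v : Fin n → Fin 3 → ℝ) : Prop :=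
  ∀ i j k, i < j → j < k → 0 ≤ det3 (v i) (v j) (v k)

/-- All `3 × 3` minors are positive. -/
def TPos {n : ℕ} (v : Fin n → Fin 3 → ℝ) : Prop :=
  ∀ i j k, i < j → j < k → 0 < det3 (v i) (v j) (v k)

/-- A 3-cycle is an even permutation, so in rank three nonnegativity is invariant under rotation of
the indices. This is why all later arguments use cyclic order. -/
theorem TNonneg.cyc {n : ℕ} {v : Fin n → Fin 3 → ℝ} (hv : TNonneg v) {i j k : Fin n}
    (h : Cyc i j k) : 0 ≤ det3 (v i) (v j) (v k) := by
  rcases h with ⟨h1, h2⟩ | ⟨h1, h2⟩ | ⟨h1, h2⟩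
  · exact hv _ _ _ h1 h2
  · rw [← det3_rotate]; exact hv _ _ _ h1 h2
  · rw [← det3_rotate, ← det3_rotate]; exact hv _ _ _ h1 h2

theorem Cyc.rotate {n : ℕ} {i j k : Fin n} (h : Cyc i j k) : Cyc j k i := by
  unfold Cyc at *; omega

theorem cyc_or_cyc {n : ℕ} {i j k : Fin n} (h1 : i ≠ j) (h2 : j ≠ k) (h3 : i ≠ k) :
    Cyc i j k ∨ Cyc i k j := by
  unfold Cyc; omega

theorem TNonneg.cyc_of_pos {n : ℕ} {v : Fin n → Fin 3 → ℝ} (hv : TNonneg v) {i j k : Fin n}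
    (h : 0 < det3 (v i) (v j) (v k)) : Cyc i j k := by
  have h1 : i ≠ j := by rintro rfl; simp at h
  have h2 : j ≠ k := by rintro rfl; simp at h
  have h3 : i ≠ k := by rintro rfl; simp at h
  refine (cyc_or_cyc h1 h2 h3).resolve_right fun hc => ?_
  have := hv.cyc hc
  rw [det3_swap_right] at this
  linarith

theorem TNonneg.cyc_of_neg {n : ℕ} {v : Fin n → Fin 3 → ℝ} (hv : TNonneg v) {i j k : Fin n}
    (h : det3 (v i) (v j) (v k) < 0) : Cyc i k j := by
  apply hv.cyc_of_pos
  rw [det3_swap_right]; linarith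

/-! ### Configurations on conics, up to linear changes of positive determinant. -/

/-- The vectors lie on a common nondegenerate conic with a point, in suitable coordinates
`x z = y ^ 2`. -/
def OnConic {n : ℕ} (v : Fin n → Fin 3 → ℝ) : Prop :=
  ∃ h : Matrix (Fin 3) (Fin 3) ℝ, h.det ≠ 0 ∧
    ∀ i, h.mulVec (v i) 0 * h.mulVec (v i) 2 = h.mulVec (v i) 1 ^ 2

/-- The condition that any six of the vectors lie on a conic. -/
def SixRel {n : ℕ} (v : Fin n → Fin 3 → ℝ) : Prop :=
  ∀ a b c d e f,
    det3 (v a) (v b) (v c) * det3 (v a) (v d) (v e) * det3 (v b) (v d) (v f) *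
        det3 (v c) (v e) (v f) =
      det3 (v a) (v b) (v d) * det3 (v a) (v c) (v e) * det3 (v b) (v c) (v f) *
        det3 (v d) (v e) (v f)

/-- The configurations that are positive and lie on a nondegenerate conic. -/
def posConic (n : ℕ) : Set (Fin n → Fin 3 → ℝ) := {w | OnConic w ∧ TPos w}

theorem OnConic.mulVec {n : ℕ} {v : Fin n → Fin 3 → ℝ} (hv : OnConic v)
    {g : Matrix (Fin 3) (Fin 3) ℝ} (hg : g.det ≠ 0) : OnConic fun i => g.mulVec (v i) := by
  obtain ⟨h, hh, H⟩ := hv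
  refine ⟨h * g⁻¹, ?_, fun i => ?_⟩
  · rw [Matrix.det_mul, Matrix.det_nonsing_inv, Ring.inverse_eq_inv']
    exact mul_ne_zero hh (inv_ne_zero hg)
  · rw [Matrix.mulVec_mulVec, Matrix.mul_assoc, Matrix.nonsing_inv_mul _ (isUnit_iff_ne_zero.2 hg),
      Matrix.mul_one]
    exact H i

theorem mulVec_mem_posConic {n : ℕ} {v : Fin n → Fin 3 → ℝ} (hv : v ∈ posConic n)
    {g : Matrix (Fin 3) (Fin 3) ℝ} (hg : 0 < g.det) : (fun i => g.mulVec (v i)) ∈ posConic n := by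
  refine ⟨hv.1.mulVec hg.ne', fun i j k hij hjk => ?_⟩
  rw [det3_mulVec]
  exact mul_pos hg (hv.2 i j k hij hjk)

theorem mulVec_mem_closure_posConic {n : ℕ} {v : Fin n → Fin 3 → ℝ}
    (hv : v ∈ closure (posConic n)) {g : Matrix (Fin 3) (Fin 3) ℝ} (hg : 0 < g.det) :
    (fun i => g.mulVec (v i)) ∈ closure (posConic n) := by
  have hc : Continuous fun (v : Fin n → Fin 3 → ℝ) i => g.mulVec (v i) :=
    continuous_pi fun i => Continuous.matrix_mulVec continuous_const (continuous_apply i)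
  exact map_mem_closure hc hv fun w hw => mulVec_mem_posConic hw hg

theorem mem_closure_posConic_of_mulVec {n : ℕ} {v : Fin n → Fin 3 → ℝ}
    {g : Matrix (Fin 3) (Fin 3) ℝ} (hg : 0 < g.det)
    (h : (fun i => g.mulVec (v i)) ∈ closure (posConic n)) : v ∈ closure (posConic n) := by
  have hg' : 0 < g⁻¹.det := by
    rw [Matrix.det_nonsing_inv, Ring.inverse_eq_inv']; positivity
  have := mulVec_mem_closure_posConic h hg'
  simpa only [Matrix.mulVec_mulVec, Matrix.nonsing_inv_mul _ (isUnit_iff_ne_zero.2 hg.ne'),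
    Matrix.one_mulVec] using this

/-! ### The standard conic: reduction to 2 × n matrices. -/

/-- The Veronese vector `(a ^ 2, a b, b ^ 2)`. -/
def ver (a b : ℝ) : Fin 3 → ℝ := ![a ^ 2, a * b, b ^ 2]

/-- The minor of a `2 × n` matrix with rows `a`, `b` on the columns `i`, `j`. -/
def minor2 {n : ℕ} (a b : Fin n → ℝ) (i j : Fin n) : ℝ := a i * b j - a j * b i

theorem det3_ver (a b c d e f : ℝ) : det3 (ver a b) (ver c d) (ver e f) =
    (a * d - c * b) * (a * f - e * b) * (c * f - e * d) := by
  simp [det3, ver]; ring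

theorem onConic_ver {n : ℕ} (a b : Fin n → ℝ) : OnConic fun i => ver (a i) (b i) :=
  ⟨1, by simp, fun i => by simp [ver]; ring⟩

/-- If the products of the three `2 × 2` minors of any three columns are nonnegative, then the
columns may be given signs for which all `2 × 2` minors are nonnegative. -/
theorem exists_signs {n : ℕ} {a b : Fin n → ℝ}
    (hD : ∀ i j k, i < j → j < k → 0 ≤ minor2 a b i j * minor2 a b i k * minor2 a b j k)
    (hpos : ∃ i j k, i < j ∧ j < k ∧
      0 < minor2 a b i j * minor2 a b i k * minor2 a b j k) :
    ∃ e : Fin n → ℝ, (∀ i, e i ^ 2 = 1) ∧ ∀ i j, i < j → 0 ≤ e i * e j * minor2 a b i j := by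
  classical
  obtain ⟨x, y, z, -, -, hxyz⟩ := hpos
  have hx : ∃ i, (a i ≠ 0 ∨ b i ≠ 0) := by
    refine ⟨x, ?_⟩
    by_contra! h
    simp [minor2, h.1, h.2] at hxyz
  -- The first nonzero column `o` is the reference: `q` measures the area with it, `d` the inner
  -- product, and `hid` recovers every minor from these two.
  obtain ⟨o, ho, homin⟩ : ∃ o, (a o ≠ 0 ∨ b o ≠ 0) ∧ ∀ j < o, a j = 0 ∧ b j = 0 := by
    have hne : (Finset.univ.filter fun i => a i ≠ 0 ∨ b i ≠ 0).Nonempty := by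
      obtain ⟨i, hi⟩ := hx
      exact ⟨i, by simpa using hi⟩
    refine ⟨Finset.min' _ hne, by simpa using Finset.min'_mem _ hne, fun j hj => ?_⟩
    by_contra h
    refine absurd (Finset.min'_le (Finset.univ.filter fun i => a i ≠ 0 ∨ b i ≠ 0) j ?_)
      (not_le.2 hj)
    simp only [Finset.mem_filter, Finset.mem_univ, true_and]
    tauto
  set s := a o ^ 2 + b o ^ 2 with hs_def
  have hs : 0 < s := by
    rcases ho with h | h
    · have := sq_pos_of_ne_zero h; have := sq_nonneg (b o); linarith
    · have := sq_pos_of_ne_zero h; have := sq_nonneg (a o); linarith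
  set q := fun i => minor2 a b o i with hq
  set d := fun i => a o * a i + b o * b i with hd
  have hid : ∀ i j, s * minor2 a b i j = d i * q j - d j * q i := by
    intro i j; simp only [hs_def, hd, hq, minor2]; ring
  have hR : ∀ i, q i ≠ 0 → o < i := by
    intro i hi
    rcases lt_trichotomy o i with h | h | h
    · exact h
    · subst h; simp [hq, minor2] at hi
    · have := homin i h; simp [hq, minor2, this] at hi
  obtain ⟨m₁, m₂, hm₁, hm₂, hm⟩ : ∃ m₁ m₂, q m₁ ≠ 0 ∧ q m₂ ≠ 0 ∧ minor2 a b m₁ m₂ ≠ 0 := by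
    have h1 : minor2 a b x y ≠ 0 := by rintro h; simp [h] at hxyz
    have h2 : minor2 a b x z ≠ 0 := by rintro h; simp [h] at hxyz
    have h3 : minor2 a b y z ≠ 0 := by rintro h; simp [h] at hxyz
    have key : ∀ i j, minor2 a b i j ≠ 0 → q i ≠ 0 ∨ q j ≠ 0 := by
      intro i j hij
      by_contra! h
      have := hid i j
      rw [h.1, h.2] at this
      simp [hs.ne', hij] at this
    by_cases hx : q x = 0
    · exact ⟨y, z, (key x y h1).resolve_left (by simp [hx]),
        (key x z h2).resolve_left (by simp [hx]), h3⟩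
    · by_cases hy : q y = 0
      · exact ⟨x, z, hx, (key y z h3).resolve_left (by simp [hy]), h2⟩
      · exact ⟨x, y, hx, hy, h1⟩
  -- For `j` parallel to `o`, the minors with `j` are multiples of `q`. The triple products on `k' j
  -- k` and on `o k' k` then have opposite signs, so both vanish.
  have hzero : ∀ j k' k, q j = 0 → d j ≠ 0 → k' < j → j < k → q k' ≠ 0 → q k ≠ 0 →
      minor2 a b k' k = 0 := by
    intro j k' k hj hdj hk' hk hqk' hqk
    have h1 := hD k' j k hk' hk
    have h2 := hD o k' k (hR _ hqk') (hk'.trans hk)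
    have e1 := hid k' j
    have e2 := hid j k
    rw [hj] at e1 e2
    have h2' : 0 ≤ q k' * q k * minor2 a b k' k := h2
    have h3 : 0 ≤ -(d j ^ 2 * (q k' * q k * minor2 a b k' k)) := by
      have : -(d j ^ 2 * (q k' * q k * minor2 a b k' k)) =
          s ^ 2 * (minor2 a b k' j * minor2 a b k' k * minor2 a b j k) := by
        linear_combination (-minor2 a b k' k * s * minor2 a b j k) * e1 +
          (d j * q k' * minor2 a b k' k) * e2
      rw [this]; positivity
    have h4 : d j ^ 2 * (q k' * q k * minor2 a b k' k) = 0 :=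
      le_antisymm (by linarith) (by positivity)
    simpa [hdj, hqk, hqk'] using h4
  -- If `m₁` and `m₂` lie on opposite sides of `j`, `hzero` makes them dependent. If they lie on the
  -- same side, both are parallel to a column on the other side, which the three-term Plücker
  -- relation `hpl` forbids.
  have hsep : ∀ j k' k, q j = 0 → d j ≠ 0 → k' < j → j < k → q k' ≠ 0 → q k ≠ 0 → False := by
    intro j k' k hj hdj hk' hk hqk' hqk
    have hj₁ : m₁ ≠ j := by rintro rfl; exact hm₁ hj
    have hj₂ : m₂ ≠ j := by rintro rfl; exact hm₂ hj
    have hpl : ∀ t, q t * minor2 a b m₁ m₂ = q m₁ * minor2 a b t m₂ - q m₂ * minor2 a b t m₁ := by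
      intro t; simp only [hq, minor2]; ring
    have hanti : ∀ s t, minor2 a b s t = -minor2 a b t s := by
      intro s t; simp only [minor2]; ring
    rcases lt_or_gt_of_ne hj₁ with h1 | h1 <;> rcases lt_or_gt_of_ne hj₂ with h2 | h2
    · have e1 := hzero j m₁ k hj hdj h1 hk hm₁ hqk
      have e2 := hzero j m₂ k hj hdj h2 hk hm₂ hqk
      have := hpl k
      rw [hanti k m₂, hanti k m₁, e1, e2] at this
      simp [hqk, hm] at this
    · exact hm (hzero j m₁ m₂ hj hdj h1 h2 hm₁ hm₂)
    · exact hm (by rw [hanti, hzero j m₂ m₁ hj hdj h2 h1 hm₂ hm₁, neg_zero])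
    · have e1 := hzero j k' m₁ hj hdj hk' h1 hqk' hm₁
      have e2 := hzero j k' m₂ hj hdj hk' h2 hqk' hm₂
      have := hpl k'
      rw [e1, e2] at this
      simp [hqk', hm] at this
  -- A column off the line of `o` gets the sign making `q` nonnegative. A column on that line points
  -- along `o` if columns off the line follow it, and against `o` otherwise; `hsep` rules out a
  -- conflict.
  have hex : ∀ j, ∃ e : ℝ, e ^ 2 = 1 ∧ 0 ≤ e * q j ∧ (q j = 0 →
      (∀ k, j < k → q k ≠ 0 → 0 ≤ e * d j) ∧ ∀ k, k < j → q k ≠ 0 → e * d j ≤ 0) := by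
    intro j
    by_cases hj : q j = 0
    · obtain ⟨e, he, hed⟩ : ∃ e : ℝ, e ^ 2 = 1 ∧ 0 ≤ e * d j := by
        rcases le_total 0 (d j) with h | h
        · exact ⟨1, by norm_num, by linarith⟩
        · exact ⟨-1, by norm_num, by linarith⟩
      by_cases hk : ∃ k, j < k ∧ q k ≠ 0
      · obtain ⟨k, hk, hqk⟩ := hk
        refine ⟨e, he, by simp [hj], fun _ => ⟨fun _ _ _ => hed, fun k' hk' hqk' => ?_⟩⟩
        by_cases hdj : d j = 0
        · simp [hdj]
        · exact (hsep j k' k hj hdj hk' hk hqk' hqk).elim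
      · push Not at hk
        refine ⟨-e, by rw [neg_sq, he], by simp [hj], fun _ =>
          ⟨fun k h1 h2 => (h2 (hk k h1)).elim, fun _ _ _ => by linarith⟩⟩
    · rcases le_total 0 (q j) with h | h
      · exact ⟨1, by norm_num, by linarith, fun h' => (hj h').elim⟩
      · exact ⟨-1, by norm_num, by linarith, fun h' => (hj h').elim⟩
  choose e he heq hed using hex
  refine ⟨e, he, fun i j hij => ?_⟩
  have e0 : s * (e i * e j * minor2 a b i j) =
      (e i * d i) * (e j * q j) - (e j * d j) * (e i * q i) := by
    linear_combination (e i * e j) * hid i j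
  by_cases hi : q i = 0
  · refine nonneg_of_mul_nonneg_right (a := s) ?_ hs
    rw [e0, hi]
    by_cases hj : q j = 0
    · simp [hj]
    · have := (hed i hi).1 j hij hj
      have := mul_nonneg this (heq j)
      linarith
  · by_cases hj : q j = 0
    · refine nonneg_of_mul_nonneg_right (a := s) ?_ hs
      rw [e0, hj]
      have := (hed j hj).2 i hij hi
      have := mul_nonneg (neg_nonneg.2 this) (heq i)
      linarith
    · have hne : ∀ i, e i ≠ 0 := fun i h => by have := he i; simp [h] at this
      have h1 : 0 < e i * q i := lt_of_le_of_ne (heq i) (mul_ne_zero (hne i) hi).symm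
      have h2 : 0 < e j * q j := lt_of_le_of_ne (heq j) (mul_ne_zero (hne j) hj).symm
      have h3 := hD o i j (hR i hi) hij
      refine nonneg_of_mul_nonneg_right (a := (e i * q i) * (e j * q j)) ?_ (mul_pos h1 h2)
      have : (e i * q i) * (e j * q j) * (e i * e j * minor2 a b i j) =
          (e i ^ 2 * e j ^ 2) * (q i * q j * minor2 a b i j) := by ring
      rw [this, he, he]
      simpa using h3

/-- The totally positive matrix with entries `q ^ ((k - j) ^ 2)`. -/
def gaussian {n : ℕ} (q : ℝ) (k j : Fin n) : ℝ := q ^ (((k : ℤ) - (j : ℤ)) ^ 2).toNat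

/-- Since `0 < q < 1`, the diagonal product wins: its exponent is smaller by `2 (l - k) (j - i)`. -/
theorem gaussian_minor_pos {n : ℕ} {q : ℝ} (h0 : 0 < q) (h1 : q < 1) {k l i j : Fin n}
    (hkl : k < l) (hij : i < j) :
    0 < gaussian q k i * gaussian q l j - gaussian q k j * gaussian q l i := by
  unfold gaussian
  rw [← pow_add, ← pow_add, sub_pos]
  apply pow_lt_pow_right_of_lt_one₀ h0 h1
  zify
  rw [Int.toNat_of_nonneg (sq_nonneg _), Int.toNat_of_nonneg (sq_nonneg _),
    Int.toNat_of_nonneg (sq_nonneg _), Int.toNat_of_nonneg (sq_nonneg _)]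
  have hk : (k : ℤ) < l := by exact_mod_cast hkl
  have hi : (i : ℤ) < j := by exact_mod_cast hij
  nlinarith [mul_pos (sub_pos.2 hk) (sub_pos.2 hi)]

/-- Cauchy–Binet: twice the new minor is the sum, over all ordered pairs of columns, of an old minor
times a Gaussian minor. Both factors change sign together, so every term is nonnegative, and one is
positive. -/
theorem minor2_gaussian_pos {n : ℕ} {a b : Fin n → ℝ}
    (hN : ∀ i j, i < j → 0 ≤ minor2 a b i j) (hne : ∃ i j, minor2 a b i j ≠ 0)
    {q : ℝ} (h0 : 0 < q) (h1 : q < 1) {i j : Fin n} (hij : i < j) :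
    0 < minor2 (fun j => ∑ k, gaussian q k j * a k) (fun j => ∑ k, gaussian q k j * b k) i j := by
  set t := fun k l => gaussian q k i * gaussian q l j - gaussian q k j * gaussian q l i with ht
  have hanti : ∀ k l, t l k = -t k l := fun k l => by simp only [ht]; ring
  have e1 : minor2 (fun j => ∑ k, gaussian q k j * a k) (fun j => ∑ k, gaussian q k j * b k) i j
      = ∑ k, ∑ l, a k * b l * t k l := by
    simp only [minor2, Finset.sum_mul_sum, ← Finset.sum_sub_distrib, ht]
    exact Finset.sum_congr rfl fun k _ => Finset.sum_congr rfl fun l _ => by ring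
  have e2 : 2 * (∑ k, ∑ l, a k * b l * t k l) = ∑ k, ∑ l, minor2 a b k l * t k l := by
    have : ∑ k, ∑ l, a k * b l * t k l = ∑ k, ∑ l, -(a l * b k * t k l) := by
      rw [Finset.sum_comm]
      exact Finset.sum_congr rfl fun k _ => Finset.sum_congr rfl fun l _ => by rw [hanti]; ring
    rw [two_mul]
    nth_rewrite 2 [this]
    simp only [← Finset.sum_add_distrib, minor2]
    exact Finset.sum_congr rfl fun k _ => Finset.sum_congr rfl fun l _ => by ring
  have hm : ∀ k l, minor2 a b l k = -minor2 a b k l := fun k l => by simp only [minor2]; ring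
  have hle : ∀ k l, 0 ≤ minor2 a b k l * t k l := by
    intro k l
    rcases lt_trichotomy k l with h | h | h
    · exact mul_nonneg (hN k l h) (gaussian_minor_pos h0 h1 h hij).le
    · subst h; simp [minor2, mul_comm]
    · rw [hm l k, hanti l k, neg_mul_neg]
      exact mul_nonneg (hN l k h) (gaussian_minor_pos h0 h1 h hij).le
  have hpos : 0 < ∑ k, ∑ l, minor2 a b k l * t k l := by
    obtain ⟨k, l, hkl⟩ := hne
    refine Finset.sum_pos' (fun k _ => Finset.sum_nonneg fun l _ => hle k l)
      ⟨k, Finset.mem_univ _, Finset.sum_pos' (fun l _ => hle k l) ⟨l, Finset.mem_univ _, ?_⟩⟩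
    refine lt_of_le_of_ne (hle k l) (mul_ne_zero hkl ?_).symm
    rcases lt_trichotomy k l with h | h | h
    · exact (gaussian_minor_pos h0 h1 h hij).ne'
    · subst h; simp [minor2] at hkl
    · rw [hanti l k, neg_ne_zero]
      exact (gaussian_minor_pos h0 h1 h hij).ne'
  rw [e1]; linarith

theorem continuous_ver {X : Type*} [TopologicalSpace X] {a b : X → ℝ} (ha : Continuous a)
    (hb : Continuous b) : Continuous fun x => ver (a x) (b x) := by
  unfold ver
  refine continuous_pi fun i => ?_
  fin_cases i <;> simp <;> fun_prop

/-- A nonnegative configuration on the standard conic is a limit of positive ones. -/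
theorem ver_mem_closure {n : ℕ} {a b : Fin n → ℝ}
    (hN : TNonneg fun i => ver (a i) (b i))
    (hpos : ∃ i j k, i < j ∧ j < k ∧
      0 < det3 (ver (a i) (b i)) (ver (a j) (b j)) (ver (a k) (b k))) :
    (fun i => ver (a i) (b i)) ∈ closure (posConic n) := by
  have hN' : ∀ i j k, i < j → j < k →
      0 ≤ minor2 a b i j * minor2 a b i k * minor2 a b j k := by
    intro i j k hij hjk
    have := hN i j k hij hjk
    rwa [det3_ver] at this
  have hpos' : ∃ i j k, i < j ∧ j < k ∧
      0 < minor2 a b i j * minor2 a b i k * minor2 a b j k := by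
    obtain ⟨i, j, k, hij, hjk, h⟩ := hpos
    exact ⟨i, j, k, hij, hjk, by rwa [det3_ver] at h⟩
  obtain ⟨e, he, hem⟩ := exists_signs hN' hpos'
  set a' := fun i => e i * a i with ha'
  set b' := fun i => e i * b i with hb'
  have hver : (fun i => ver (a i) (b i)) = fun i => ver (a' i) (b' i) := by
    funext i
    have h := he i
    ext r
    fin_cases r <;> simp [ver, ha', hb']
    · rw [mul_pow, h, one_mul]
    · linear_combination (-(a i * b i)) * h
    · rw [mul_pow, h, one_mul]
  have hm : ∀ i j, minor2 a' b' i j = e i * e j * minor2 a b i j := by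
    intro i j; simp only [minor2, ha', hb']; ring
  have hN₂ : ∀ i j, i < j → 0 ≤ minor2 a' b' i j := fun i j h => by rw [hm]; exact hem i j h
  have hne : ∃ i j, minor2 a' b' i j ≠ 0 := by
    obtain ⟨i, j, k, hij, hjk, h⟩ := hpos'
    refine ⟨i, j, ?_⟩
    have h1 : ∀ i, e i ≠ 0 := fun i h => by have := he i; simp [h] at this
    rw [hm]
    refine mul_ne_zero (mul_ne_zero (h1 i) (h1 j)) ?_
    intro h0; simp [h0] at h
  set F : ℝ → Fin n → Fin 3 → ℝ := fun q i =>
    ver (∑ k, gaussian q k i * a' k) (∑ k, gaussian q k i * b' k) with hF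
  have hcont : Continuous F := by
    refine continuous_pi fun i => continuous_ver ?_ ?_ <;>
    · unfold gaussian; fun_prop
  -- At `q = 0` the Gaussian matrix is the identity, because `0 ^ 0 = 1`.
  have h0 : ∀ k i : Fin n, gaussian 0 k i = if k = i then 1 else 0 := by
    intro k i
    unfold gaussian
    split_ifs with h
    · simp [h]
    · apply zero_pow
      have : (k : ℤ) - i ≠ 0 := by
        rw [sub_ne_zero]; intro h'; exact h (Fin.ext (by exact_mod_cast h'))
      have := sq_pos_of_ne_zero this
      omega
  have hF0 : F 0 = fun i => ver (a' i) (b' i) := by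
    funext i
    simp [hF, h0]
  rw [hver, ← hF0]
  refine mem_closure_of_tendsto (hcont.continuousWithinAt (s := Set.Ioi 0)).tendsto ?_
  have : ∀ᶠ q : ℝ in 𝓝[>] 0, q < 1 :=
    nhdsWithin_le_nhds (Iio_mem_nhds one_pos)
  filter_upwards [this, self_mem_nhdsWithin] with q hq1 hq0
  refine ⟨onConic_ver _ _, fun i j k hij hjk => ?_⟩
  simp only [hF]
  rw [det3_ver]
  have := fun {i j : Fin n} (h : i < j) => minor2_gaussian_pos hN₂ hne hq0 hq1 h
  exact mul_pos (mul_pos (this hij) (this (hij.trans hjk))) (this hjk)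

/-! ### Smoothing a wedge of two planes. -/

/-- A deformation of a vector `u` in one of the planes `u 0 = 0`, `u 2 = 0` to the conic
`x z = (s y) ^ 2`. -/
noncomputable def smoothing (s : ℝ) (u : Fin 3 → ℝ) : Fin 3 → ℝ :=
  if 0 < u 0 then ![u 0, u 1, s ^ 2 * u 1 ^ 2 / u 0]
  else if 0 < u 2 then ![s ^ 2 * u 1 ^ 2 / u 2, u 1, u 2]
  -- On the common line of the planes, the absolute values keep the outer coordinates nonnegative,
  -- as a real Veronese parametrisation requires.
  else ![s * |u 1|, u 1, s * |u 1|]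

/-- The half turn exchanging the planes `u 0 = 0` and `u 2 = 0`. -/
def halfTurn (u : Fin 3 → ℝ) : Fin 3 → ℝ := ![u 2, -u 1, u 0]

theorem det3_halfTurn (u v w : Fin 3 → ℝ) :
    det3 (halfTurn u) (halfTurn v) (halfTurn w) = det3 u v w := by
  simp [det3, halfTurn]; ring

theorem smoothing_halfTurn (s : ℝ) {u : Fin 3 → ℝ} (h : u 0 * u 2 = 0) :
    smoothing s (halfTurn u) = halfTurn (smoothing s u) := by
  unfold smoothing
  by_cases h0 : 0 < u 0
  · have h2 : u 2 = 0 := by simpa [h0.ne'] using h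
    simp [halfTurn, h0, h2]
  · by_cases h2 : 0 < u 2 <;> simp [halfTurn, h0, h2]

theorem smoothing_conic {s : ℝ} (hs : 0 < s) (u : Fin 3 → ℝ) :
    0 ≤ smoothing s u 0 ∧ 0 ≤ smoothing s u 2 ∧
      smoothing s u 0 * smoothing s u 2 = (s * smoothing s u 1) ^ 2 := by
  unfold smoothing
  split_ifs with h0 h2
  · simp
    refine ⟨h0.le, by positivity, by field_simp⟩
  · simp
    refine ⟨by positivity, h2.le, by field_simp⟩
  · simp
    refine ⟨by positivity, ?_⟩
    rw [mul_pow, mul_mul_mul_comm, abs_mul_abs_self]; ring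

/-- Square roots of the outer coordinates give `a` and `b` up to sign; the sign `e` adjusts `b` to
the sign of the middle coordinate. -/
theorem exists_ver {s : ℝ} (hs : 0 < s) {w : Fin 3 → ℝ} (h0 : 0 ≤ w 0) (h2 : 0 ≤ w 2)
    (h : w 0 * w 2 = (s * w 1) ^ 2) :
    ∃ a b, w = (Matrix.diagonal ![1, 1, s ^ 2]).mulVec (ver a b) := by
  have key : √(w 0) * √(w 2) = s * |w 1| := by
    rw [← Real.sqrt_mul h0, h, Real.sqrt_sq_eq_abs, abs_mul, abs_of_pos hs]
  obtain ⟨e, he, hew⟩ : ∃ e : ℝ, e ^ 2 = 1 ∧ e * |w 1| = w 1 := by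
    rcases le_total 0 (w 1) with h | h
    · exact ⟨1, by norm_num, by rw [abs_of_nonneg h, one_mul]⟩
    · exact ⟨-1, by norm_num, by rw [abs_of_nonpos h]; ring⟩
  refine ⟨√(w 0), e * √(w 2) / s, ?_⟩
  ext i
  rw [Matrix.mulVec_diagonal]
  fin_cases i
  · simp [ver, Real.sq_sqrt h0]
  · simp only [ver]
    simp only [Fin.mk_one, Matrix.cons_val_one, Matrix.cons_val_zero, one_mul]
    rw [eq_comm, ← mul_div_assoc, div_eq_iff hs.ne']
    linear_combination e * key + s * hew
  · simp [ver, div_pow, mul_pow, he, Real.sq_sqrt h2]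
    field_simp

theorem tendsto_smoothing (u : Fin 3 → ℝ) (h0 : 0 ≤ u 0) (h2 : 0 ≤ u 2) (h : u 0 * u 2 = 0) :
    Tendsto (fun s => smoothing s u) (𝓝[>] 0) (𝓝 u) := by
  have hc : Continuous fun s => smoothing s u := by
    unfold smoothing
    split_ifs
    all_goals
      refine continuous_pi fun i => ?_
      fin_cases i <;> simp <;> fun_prop
  have hz : smoothing 0 u = u := by
    unfold smoothing
    split_ifs with h1 h3
    · have h2 : u 2 = 0 := by simpa [h1.ne'] using h
      ext i; fin_cases i <;> simp [h2]
    · have h2 : u 0 = 0 := by simpa [h3.ne'] using h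
      ext i; fin_cases i <;> simp [h2]
    · have h4 : u 0 = 0 := le_antisymm (not_lt.1 h1) h0
      have h5 : u 2 = 0 := le_antisymm (not_lt.1 h3) h2
      ext i; fin_cases i <;> simp [h4, h5]
  have := (hc.continuousWithinAt (s := Set.Ioi 0) (x := 0)).tendsto
  rwa [hz] at this

/-- The shape of the smoothing of a vector of the plane `u 2 = 0`. -/
theorem smoothing_form {s : ℝ} (hs : 0 < s) {u : Fin 3 → ℝ} (h0 : 0 ≤ u 0) (h2 : u 2 = 0)
    (hsm : 0 < u 0 → s * |u 1| < u 0) :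
    smoothing s u = 0 ∨ ∃ A, 0 < A ∧ smoothing s u = ![A, u 1, s ^ 2 * u 1 ^ 2 / A] ∧
      ((A = u 0 ∧ -A < s * u 1 ∧ s * u 1 < A) ∨
        (u 0 = 0 ∧ ((0 < u 1 ∧ A = s * u 1) ∨ (u 1 < 0 ∧ A = -(s * u 1))))) := by
  unfold smoothing
  by_cases h : 0 < u 0
  · right
    have h1 := hsm h
    rw [← abs_of_pos hs, ← abs_mul, abs_lt] at h1
    exact ⟨u 0, h, by simp [h], Or.inl ⟨rfl, h1⟩⟩
  · have h0' : u 0 = 0 := le_antisymm (not_lt.1 h) h0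
    rcases lt_trichotomy (u 1) 0 with h1 | h1 | h1
    · right
      have hA : 0 < -(s * u 1) := by nlinarith
      refine ⟨-(s * u 1), hA, ?_, Or.inr ⟨h0', Or.inr ⟨h1, rfl⟩⟩⟩
      have e : s ^ 2 * u 1 ^ 2 / -(s * u 1) = -(s * u 1) := by
        rw [div_eq_iff hA.ne']; ring
      simp [h0', h2, abs_of_neg h1, e]
    · left
      simp [h0', h2, h1]
    · right
      have hA : 0 < s * u 1 := by positivity
      refine ⟨s * u 1, hA, ?_, Or.inr ⟨h0', Or.inl ⟨h1, rfl⟩⟩⟩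
      have e : s ^ 2 * u 1 ^ 2 / (s * u 1) = s * u 1 := by
        rw [div_eq_iff hA.ne']; ring
      simp [h0', h2, abs_of_pos h1, e]

/-- A nonzero smoothing is a positive multiple of a point of a parabola with parameter `y / A`, so
the determinant is a positive factor times a Vandermonde product. Vectors on the axis have parameter
`± 1 / s`, the others lie strictly between, so the three areas put the parameters in weak order. The
one exception is a positive axis vector before a negative one: it forces the third vector onto the
axis, and two of the smoothings are then parallel. -/
theorem det3_smoothing_nonneg {s : ℝ} (hs : 0 < s) {u v w : Fin 3 → ℝ}
    (hu0 : 0 ≤ u 0) (hu2 : u 2 = 0) (hu : 0 < u 0 → s * |u 1| < u 0)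
    (hv0 : 0 ≤ v 0) (hv2 : v 2 = 0) (hv : 0 < v 0 → s * |v 1| < v 0)
    (hw0 : 0 ≤ w 0) (hw2 : w 2 = 0) (hw : 0 < w 0 → s * |w 1| < w 0)
    (huv : 0 ≤ u 0 * v 1 - v 0 * u 1) (hvw : 0 ≤ v 0 * w 1 - w 0 * v 1)
    (huw : 0 ≤ u 0 * w 1 - w 0 * u 1) :
    0 ≤ det3 (smoothing s u) (smoothing s v) (smoothing s w) := by
  rcases smoothing_form hs hu0 hu2 hu with h | ⟨A, hA, eA, cA⟩
  · simp [h, det3]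
  rcases smoothing_form hs hv0 hv2 hv with h | ⟨B, hB, eB, cB⟩
  · simp [h, det3]
  rcases smoothing_form hs hw0 hw2 hw with h | ⟨C, hC, eC, cC⟩
  · simp [h, det3]
  have e : det3 (smoothing s u) (smoothing s v) (smoothing s w) =
      s ^ 2 / (A * B * C) * ((A * v 1 - B * u 1) * (A * w 1 - C * u 1) *
        (B * w 1 - C * v 1)) := by
    rw [eA, eB, eC]
    simp [det3]
    field_simp
    ring
  rw [e]
  refine mul_nonneg (by positivity) ?_
  clear e eA eB eC hu hv hw hu2 hv2 hw2
  generalize u 0 = x at *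
  generalize v 0 = x' at *
  generalize w 0 = x'' at *
  generalize u 1 = z at *
  generalize v 1 = z' at *
  generalize w 1 = z'' at *
  have key : ∀ {x x' z z' A B : ℝ}, 0 < A → 0 < B →
      ((A = x ∧ -A < s * z ∧ s * z < A) ∨ (x = 0 ∧ ((0 < z ∧ A = s * z) ∨ (z < 0 ∧ A = -(s * z)))))
      → ((B = x' ∧ -B < s * z' ∧ s * z' < B) ∨
        (x' = 0 ∧ ((0 < z' ∧ B = s * z') ∨ (z' < 0 ∧ B = -(s * z'))))) →
      0 ≤ x * z' - x' * z → 0 ≤ A * z' - B * z ∨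
        (x = 0 ∧ x' = 0 ∧ 0 < z ∧ z' < 0 ∧ A = s * z ∧ B = -(s * z')) := by
    rintro x x' z z' A B hA hB (⟨rfl, h1, h2⟩ | ⟨rfl, ⟨h1, rfl⟩ | ⟨h1, rfl⟩⟩)
      (⟨rfl, h3, h4⟩ | ⟨rfl, ⟨h3, rfl⟩ | ⟨h3, rfl⟩⟩) h
    · left; exact h
    · left; nlinarith
    · exfalso; nlinarith
    · exfalso; nlinarith
    · left; nlinarith
    · right; exact ⟨rfl, rfl, h1, h3, rfl, rfl⟩
    · left; nlinarith
    · left; nlinarith [mul_pos hs (mul_pos (neg_pos.2 h1) h3)]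
    · left; nlinarith
  rcases key hA hB cA cB huv with h1 | ⟨hx, hx', hz, hz', hA', hB'⟩
  · rcases key hB hC cB cC hvw with h2 | ⟨hx', hx'', hz', hz'', hB', hC'⟩
    · rcases key hA hC cA cC huw with h3 | ⟨hx, hx'', hz, hz'', hA', hC'⟩
      · exact mul_nonneg (mul_nonneg h1 h3) h2
      · rcases cB with ⟨h, -, -⟩ | ⟨h, ⟨h4, h5⟩ | ⟨h4, h5⟩⟩
        · exfalso; rw [hx] at huv; nlinarith
        · rw [hA', h5]; apply le_of_eq; ring
        · rw [hC', h5]; apply le_of_eq; ring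
    · rcases cA with ⟨h, -, -⟩ | ⟨h, ⟨h4, h5⟩ | ⟨h4, h5⟩⟩
      · exfalso; rw [hx''] at huw; nlinarith
      · rw [hB', h5]; apply le_of_eq; ring
      · rw [hC', h5]; apply le_of_eq; ring
  · rcases cC with ⟨h, -, -⟩ | ⟨h, ⟨h4, h5⟩ | ⟨h4, h5⟩⟩
    · exfalso; rw [hx] at huw; nlinarith
    · rw [hA', h5]; apply le_of_eq; ring
    · rw [hB', h5]; apply le_of_eq; ring

/-- Vectors of a plane, in cyclic order with respect to a vector off the plane. -/
theorem TNonneg.det3_smoothing_nonneg {n : ℕ} {u : Fin n → Fin 3 → ℝ} (hN : TNonneg u)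
    (h0 : ∀ i, 0 ≤ u i 0) (h00 : ∀ i, u i 0 * u i 2 = 0) {s : ℝ} (hs : 0 < s)
    (hsm : ∀ i, 0 < u i 0 → s * |u i 1| < u i 0) {l : Fin n} (hl : 0 < u l 2)
    {i j k : Fin n} (hij : i < j) (hjk : j < k) (hi : u i 2 = 0) (hj : u j 2 = 0)
    (hk : u k 2 = 0) :
    0 ≤ det3 (smoothing s (u i)) (smoothing s (u j)) (smoothing s (u k)) := by
  have hl0 : u l 0 = 0 := by simpa [hl.ne'] using h00 l
  have key : ∀ {a b : Fin n}, u a 2 = 0 → u b 2 = 0 → Cyc a b l →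
      0 ≤ u a 0 * u b 1 - u b 0 * u a 1 := by
    intro a b ha hb hab
    have := hN.cyc hab
    have e : det3 (u a) (u b) (u l) = u l 2 * (u a 0 * u b 1 - u b 0 * u a 1) := by
      simp only [det3, ha, hb, hl0]; ring
    rw [e] at this
    exact nonneg_of_mul_nonneg_right this hl
  have hil : i ≠ l := by rintro rfl; exact hl.ne' hi
  have hjl : j ≠ l := by rintro rfl; exact hl.ne' hj
  have hkl : k ≠ l := by rintro rfl; exact hl.ne' hk
  -- Cutting the cyclic order at `l` turns it into a linear order on the plane; only a rotation of
  -- `i j k` is needed.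
  have hcases : (Cyc i j l ∧ Cyc j k l ∧ Cyc i k l) ∨ (Cyc j k l ∧ Cyc k i l ∧ Cyc j i l) ∨
      (Cyc k i l ∧ Cyc i j l ∧ Cyc k j l) := by
    unfold Cyc; omega
  have main : ∀ {a b c : Fin n}, u a 2 = 0 → u b 2 = 0 → u c 2 = 0 → Cyc a b l → Cyc b c l →
      Cyc a c l → 0 ≤ det3 (smoothing s (u a)) (smoothing s (u b)) (smoothing s (u c)) := by
    intro a b c ha hb hc h1 h2 h3
    exact ABCT.det3_smoothing_nonneg hs (h0 a) ha (hsm a) (h0 b) hb (hsm b) (h0 c) hc (hsm c)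
      (key ha hb h1) (key hb hc h2) (key ha hc h3)
  rcases hcases with ⟨h1, h2, h3⟩ | ⟨h1, h2, h3⟩ | ⟨h1, h2, h3⟩
  · exact main hi hj hk h1 h2 h3
  · rw [← det3_rotate]; exact main hj hk hi h1 h2 h3
  · rw [← det3_rotate, ← det3_rotate]; exact main hk hi hj h1 h2 h3

/-- A dependent `w` on one of the two planes is zero or a positive multiple of `u` or `v`, and
smoothing is homogeneous under positive scaling. -/
theorem det3_smoothing_eq_zero {s : ℝ} {u v w : Fin 3 → ℝ} (hu : 0 < u 0) (hu2 : u 2 = 0)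
    (hv : 0 < v 2) (hv0 : v 0 = 0) (hw0 : 0 ≤ w 0) (hw2 : 0 ≤ w 2) (hw : w 0 * w 2 = 0)
    (h : det3 u v w = 0) : det3 (smoothing s u) (smoothing s v) (smoothing s w) = 0 := by
  have eu : smoothing s u = ![u 0, u 1, s ^ 2 * u 1 ^ 2 / u 0] := by simp [smoothing, hu]
  have ev : smoothing s v = ![s ^ 2 * v 1 ^ 2 / v 2, v 1, v 2] := by simp [smoothing, hv, hv0]
  simp only [det3, hu2, hv0] at h
  by_cases h0 : 0 < w 0
  · have h2 : w 2 = 0 := by simpa [h0.ne'] using hw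
    have h3 : u 0 * w 1 = w 0 * u 1 := by
      rw [h2] at h
      have : v 2 * (u 0 * w 1 - w 0 * u 1) = 0 := by linear_combination -h
      have := (mul_eq_zero.1 this).resolve_left hv.ne'
      linarith
    have : smoothing s w = (w 0 / u 0) • smoothing s u := by
      rw [eu]
      have h4 : w 1 = w 0 / u 0 * u 1 := by field_simp; linarith
      simp only [smoothing, h0, if_true]
      ext i; fin_cases i <;> simp [h4] <;> field_simp
    rw [this, det3_smul_right, det3_self_outer, mul_zero]
  · have h0' : w 0 = 0 := le_antisymm (not_lt.1 h0) hw0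
    by_cases h2 : 0 < w 2
    · have h3 : v 2 * w 1 = w 2 * v 1 := by
        rw [h0'] at h
        have : u 0 * (v 2 * w 1 - w 2 * v 1) = 0 := by linear_combination -h
        have := (mul_eq_zero.1 this).resolve_left hu.ne'
        linarith
      have : smoothing s w = (w 2 / v 2) • smoothing s v := by
        rw [ev]
        have h4 : w 1 = w 2 / v 2 * v 1 := by field_simp; linarith
        simp only [smoothing, h0, h2, if_true, if_false]
        ext i; fin_cases i <;> simp [h4] <;> field_simp
      rw [this, det3_smul_right, det3_self_right, mul_zero]
    · have h2' : w 2 = 0 := le_antisymm (not_lt.1 h2) hw2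
      have h1 : w 1 = 0 := by
        rw [h0', h2'] at h
        have : u 0 * v 2 * w 1 = 0 := by linear_combination -h
        simpa [hu.ne', hv.ne'] using this
      have : smoothing s w = 0 := by
        simp [smoothing, h0', h2', h1]
      rw [this]; simp [det3]

/-- Nonnegative configurations on the wedge `x, z ≥ 0`, `x z = 0` are limits of positive
configurations on nondegenerate conics. -/
theorem wedge_mem_closure {n : ℕ} {u : Fin n → Fin 3 → ℝ} (hN : TNonneg u)
    (hpos : ∃ i j k, i < j ∧ j < k ∧ 0 < det3 (u i) (u j) (u k))
    (h0 : ∀ i, 0 ≤ u i 0) (h2 : ∀ i, 0 ≤ u i 2) (h00 : ∀ i, u i 0 * u i 2 = 0) :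
    u ∈ closure (posConic n) := by
  have htend : Tendsto (fun s i => smoothing s (u i)) (𝓝[>] 0) (𝓝 u) :=
    tendsto_pi_nhds.2 fun i => tendsto_smoothing (u i) (h0 i) (h2 i) (h00 i)
  have hdet : ∀ i j k, Tendsto
      (fun s => det3 (smoothing s (u i)) (smoothing s (u j)) (smoothing s (u k))) (𝓝[>] 0)
      (𝓝 (det3 (u i) (u j) (u k))) := fun i j k =>
    tendsto_det3 (tendsto_pi_nhds.1 htend i) (tendsto_pi_nhds.1 htend j)
      (tendsto_pi_nhds.1 htend k)
  obtain ⟨a, b, c, hab, hbc, habc⟩ := hpos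
  have hK : ∃ k, 0 < u k 0 := by
    by_contra! h
    have : ∀ k, u k 0 = 0 := fun k => le_antisymm (h k) (h0 k)
    simp [det3, this] at habc
  have hL : ∃ l, 0 < u l 2 := by
    by_contra! h
    have : ∀ k, u k 2 = 0 := fun k => le_antisymm (h k) (h2 k)
    simp [det3, this] at habc
  obtain ⟨κ, hκ⟩ := hK
  obtain ⟨l, hl⟩ := hL
  have hpos_ev : ∀ i j k, ∀ᶠ s in 𝓝[>] (0 : ℝ), 0 < det3 (u i) (u j) (u k) →
      0 < det3 (smoothing s (u i)) (smoothing s (u j)) (smoothing s (u k)) := by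
    intro i j k
    by_cases h : 0 < det3 (u i) (u j) (u k)
    · filter_upwards [(hdet i j k).eventually (lt_mem_nhds h)] with s hs _ using hs
    · exact Eventually.of_forall fun s hs => (h hs).elim
  have hsm_ev : ∀ (x y : ℝ), ∀ᶠ s in 𝓝[>] (0 : ℝ), 0 < x → s * |y| < x := by
    intro x y
    by_cases h : 0 < x
    · have ht : Tendsto (fun s : ℝ => s * |y|) (𝓝[>] 0) (𝓝 (0 * |y|)) :=
        ((continuous_id.mul continuous_const).continuousWithinAt (s := Set.Ioi 0)).tendsto
      rw [zero_mul] at ht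
      filter_upwards [ht.eventually (gt_mem_nhds h)] with s hs _ using hs
    · exact Eventually.of_forall fun s hs => (h hs).elim
  -- The smoothed minors are only nonnegative, so each smoothed configuration is shown to be a limit
  -- of positive ones.
  rw [← closure_closure]
  refine mem_closure_of_tendsto htend ?_
  filter_upwards [eventually_all.2 fun i => eventually_all.2 fun j => eventually_all.2 fun k =>
      hpos_ev i j k, eventually_all.2 fun i => hsm_ev (u i 0) (u i 1),
      eventually_all.2 fun i => hsm_ev (u i 2) (u i 1), self_mem_nhdsWithin]
    with s hs1 hs2 hs3 hs0
  have hs : 0 < s := hs0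
  -- Positive minors persist for small `s`. A zero minor either lies in one plane, where the order
  -- of the parameters applies (after a half turn for the plane `x = 0`), or involves both planes
  -- and stays zero.
  have hNs : TNonneg fun i => smoothing s (u i) := by
    intro i j k hij hjk
    rcases (hN i j k hij hjk).lt_or_eq with h | h
    · exact (hs1 i j k h).le
    by_cases hz : u i 2 = 0 ∧ u j 2 = 0 ∧ u k 2 = 0
    · exact hN.det3_smoothing_nonneg h0 h00 hs hs2 hl hij hjk hz.1 hz.2.1 hz.2.2
    by_cases hx : u i 0 = 0 ∧ u j 0 = 0 ∧ u k 0 = 0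
    · have hN' : TNonneg fun i => halfTurn (u i) := by
        intro i j k hij hjk
        rw [det3_halfTurn]; exact hN i j k hij hjk
      have := hN'.det3_smoothing_nonneg (s := s) (l := κ) (fun i => by simpa [halfTurn] using h2 i)
        (fun i => by simpa [halfTurn, mul_comm] using h00 i) hs
        (fun i => by simpa [halfTurn] using hs3 i) (by simpa [halfTurn] using hκ) hij hjk
        (by simpa [halfTurn] using hx.1) (by simpa [halfTurn] using hx.2.1)
        (by simpa [halfTurn] using hx.2.2)
      rwa [smoothing_halfTurn s (h00 i), smoothing_halfTurn s (h00 j), smoothing_halfTurn s (h00 k),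
        det3_halfTurn] at this
    · have key : ∀ a b c, 0 < u a 0 → 0 < u b 2 → det3 (u a) (u b) (u c) = 0 →
          det3 (smoothing s (u a)) (smoothing s (u b)) (smoothing s (u c)) = 0 := by
        intro a b c ha hb hd
        exact det3_smoothing_eq_zero ha (by simpa [ha.ne'] using h00 a) hb
          (by simpa [hb.ne'] using h00 b) (h0 c) (h2 c) (h00 c) hd
      have hx' : 0 < u i 0 ∨ 0 < u j 0 ∨ 0 < u k 0 := by
        by_contra! hc
        exact hx ⟨le_antisymm hc.1 (h0 i), le_antisymm hc.2.1 (h0 j), le_antisymm hc.2.2 (h0 k)⟩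
      have hz' : 0 < u i 2 ∨ 0 < u j 2 ∨ 0 < u k 2 := by
        by_contra! hc
        exact hz ⟨le_antisymm hc.1 (h2 i), le_antisymm hc.2.1 (h2 j), le_antisymm hc.2.2 (h2 k)⟩
      have hne : ∀ a, 0 < u a 0 → 0 < u a 2 → False := fun a h1 h2 =>
        (mul_pos h1 h2).ne' (h00 a)
      apply ge_of_eq
      rcases hx' with ha | ha | ha <;> rcases hz' with hb | hb | hb
      · exact (hne _ ha hb).elim
      · exact key i j k ha hb h.symm
      · have := key i k j ha hb (by rw [det3_swap_right, ← h, neg_zero])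
        rwa [det3_swap_right, neg_eq_zero] at this
      · have := key j i k ha hb (by rw [det3_swap_left, ← h, neg_zero])
        rwa [det3_swap_left, neg_eq_zero] at this
      · exact (hne _ ha hb).elim
      · have := key j k i ha hb (by rw [det3_rotate, ← h])
        rwa [det3_rotate] at this
      · have := key k i j ha hb (by rw [det3_rotate, det3_rotate, ← h])
        rwa [det3_rotate, det3_rotate] at this
      · have := key k j i ha hb (by rw [det3_swap_left, det3_rotate, ← h, neg_zero])
        rwa [det3_swap_left, det3_rotate, neg_eq_zero] at this
      · exact (hne _ ha hb).elim
  choose a' b' hab' using fun i => exists_ver hs (smoothing_conic hs (u i)).1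
    (smoothing_conic hs (u i)).2.1 (smoothing_conic hs (u i)).2.2
  have hdetD : (Matrix.diagonal ![1, 1, s ^ 2] : Matrix (Fin 3) (Fin 3) ℝ).det = s ^ 2 := by
    simp [Matrix.det_diagonal, Fin.prod_univ_three]
  have hfun : (fun i => smoothing s (u i)) =
      fun i => (Matrix.diagonal ![1, 1, s ^ 2]).mulVec (ver (a' i) (b' i)) := funext hab'
  have hdv : ∀ i j k, det3 (smoothing s (u i)) (smoothing s (u j)) (smoothing s (u k)) =
      s ^ 2 * det3 (ver (a' i) (b' i)) (ver (a' j) (b' j)) (ver (a' k) (b' k)) := by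
    intro i j k
    rw [hab', hab', hab', det3_mulVec, hdetD]
  rw [hfun]
  refine mulVec_mem_closure_posConic (ver_mem_closure ?_ ⟨a, b, c, hab, hbc, ?_⟩)
    (by rw [hdetD]; positivity)
  · intro i j k hij hjk
    have := hNs i j k hij hjk
    simp only at this
    rw [hdv] at this
    exact nonneg_of_mul_nonneg_right this (by positivity)
  · have := hs1 a b c habc
    rw [hdv] at this
    exact pos_of_mul_pos_right this (by positivity)

/-! ### Coordinates adapted to two planes or to a conic. -/

/-- The cross product, as the covector `det3 a b`. -/
def cross (a b : Fin 3 → ℝ) : Fin 3 → ℝ :=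
  ![a 1 * b 2 - a 2 * b 1, a 2 * b 0 - a 0 * b 2, a 0 * b 1 - a 1 * b 0]

theorem cross_dotProduct (a b v : Fin 3 → ℝ) : dotProduct (cross a b) v = det3 a b v := by
  simp [dotProduct, cross, Fin.sum_univ_three, det3]; ring

theorem exists_det3_ne_zero {n : ℕ} {v : Fin n → Fin 3 → ℝ} {i j k : Fin n}
    (h : det3 (v i) (v j) (v k) ≠ 0) {a b : Fin 3 → ℝ} (hab : Indep a b) :
    ∃ l, (l = i ∨ l = j ∨ l = k) ∧ det3 a b (v l) ≠ 0 := by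
  by_contra! hc
  obtain ⟨t, ht⟩ := hab
  have e := det3_smul_eq (v i) (v j) (v k) t
  have e2 : det3 a b (det3 (v i) (v j) (v k) • t) = 0 := by
    rw [e]
    have h1 := hc i (by simp)
    have h2 := hc j (by simp)
    have h3 := hc k (by simp)
    rw [← cross_dotProduct] at *
    simp [dotProduct_add, dotProduct_smul, h1, h2, h3]
  rw [det3_smul_right] at e2
  exact (mul_ne_zero h ht) e2

/-- Coordinates adapted to two planes. -/
theorem exists_wedge_coords {n : ℕ} {v : Fin n → Fin 3 → ℝ}
    (hpos : ∃ i j k, det3 (v i) (v j) (v k) ≠ 0) {a b c d : Fin 3 → ℝ} (hab : Indep a b)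
    (hcd : Indep c d) (h0 : ∀ i, det3 a b (v i) * det3 c d (v i) = 0) :
    ∃ h : Matrix (Fin 3) (Fin 3) ℝ, 0 < h.det ∧
      ∀ w, h.mulVec w 0 = det3 c d w ∧ h.mulVec w 2 = det3 a b w := by
  obtain ⟨i, j, k, hijk⟩ := hpos
  obtain ⟨k', -, hk⟩ := exists_det3_ne_zero hijk hcd
  obtain ⟨l, -, hl⟩ := exists_det3_ne_zero hijk hab
  -- If the covectors were proportional, a vector off one plane would be off both, against `h0`.
  have hind : Indep (cross c d) (cross a b) := by
    by_contra hni
    have hne : cross c d ≠ 0 := by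
      intro h
      rw [← cross_dotProduct, h] at hk
      simp at hk
    obtain ⟨r, hr⟩ := exists_smul_of_not_indep hne hni
    have e : ∀ w, det3 a b w = r * det3 c d w := by
      intro w
      rw [← cross_dotProduct, ← cross_dotProduct, hr, smul_dotProduct, smul_eq_mul]
    have h1 := h0 l
    have h2 : r ≠ 0 := by rintro rfl; rw [e] at hl; simp at hl
    rw [e] at h1 hl
    have h3 : det3 c d (v l) ≠ 0 := by intro h; simp [h] at hl
    exact mul_ne_zero hl h3 h1
  obtain ⟨t, ht⟩ := hind
  -- Scaling the middle row by `r` makes the determinant the square `r ^ 2`, hence positive.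
  set r : ℝ := -det3 (cross c d) (cross a b) t with hr
  have hdet : (Matrix.of ![cross c d, r • t, cross a b]).det = r ^ 2 := by
    simp only [Matrix.det_fin_three, hr, det3, Matrix.of_apply, Matrix.cons_val, Pi.smul_apply,
      smul_eq_mul]
    ring
  have hr0 : r ≠ 0 := by rw [hr]; exact neg_ne_zero.2 ht
  refine ⟨Matrix.of ![cross c d, r • t, cross a b], by rw [hdet]; positivity, fun w => ⟨?_, ?_⟩⟩
  · rw [← cross_dotProduct]; rfl
  · rw [← cross_dotProduct]; rfl

/-- Nonnegative configurations in the boundary of a wedge are limits of positive configurations on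
nondegenerate conics. -/
theorem mem_closure_of_wedge {n : ℕ} {v : Fin n → Fin 3 → ℝ} (hN : TNonneg v)
    (hpos : ∃ i j k, i < j ∧ j < k ∧ 0 < det3 (v i) (v j) (v k)) {a b c d : Fin 3 → ℝ}
    (hab : Indep a b) (hcd : Indep c d) (hf : ∀ i, 0 ≤ det3 a b (v i))
    (hg : ∀ i, 0 ≤ det3 c d (v i)) (h0 : ∀ i, det3 a b (v i) * det3 c d (v i) = 0) :
    v ∈ closure (posConic n) := by
  obtain ⟨i, j, k, hij, hjk, hijk⟩ := hpos
  obtain ⟨h, hh, H⟩ := exists_wedge_coords ⟨i, j, k, hijk.ne'⟩ hab hcd h0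
  refine mem_closure_posConic_of_mulVec hh (wedge_mem_closure ?_ ⟨i, j, k, hij, hjk, ?_⟩ ?_ ?_ ?_)
  · intro i j k hij hjk
    rw [det3_mulVec]
    exact mul_nonneg hh.le (hN i j k hij hjk)
  · rw [det3_mulVec]
    exact mul_pos hh hijk
  · intro i; rw [(H _).1]; exact hg i
  · intro i; rw [(H _).2]; exact hf i
  · intro i; rw [(H _).1, (H _).2, mul_comm]; exact h0 i

theorem mem_closure_of_eq_mulVec_ver {n : ℕ} {v : Fin n → Fin 3 → ℝ} (hN : TNonneg v)
    (hpos : ∃ i j k, i < j ∧ j < k ∧ 0 < det3 (v i) (v j) (v k))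
    {g : Matrix (Fin 3) (Fin 3) ℝ} (hg : 0 < g.det) {a b : Fin n → ℝ}
    (h : ∀ i, v i = g.mulVec (ver (a i) (b i))) : v ∈ closure (posConic n) := by
  have hd : ∀ i j k, det3 (v i) (v j) (v k) =
      g.det * det3 (ver (a i) (b i)) (ver (a j) (b j)) (ver (a k) (b k)) := by
    intro i j k; rw [h, h, h, det3_mulVec]
  have hv : v = fun i => g.mulVec (ver (a i) (b i)) := funext h
  obtain ⟨i, j, k, hij, hjk, hijk⟩ := hpos
  rw [hv]
  refine mulVec_mem_closure_posConic (ver_mem_closure ?_ ⟨i, j, k, hij, hjk, ?_⟩) hg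
  · intro i j k hij hjk
    have := hN i j k hij hjk
    rw [hd] at this
    exact nonneg_of_mul_nonneg_right this hg
  · rw [hd] at hijk
    exact pos_of_mul_pos_right hijk hg.le

/-- A nonnegative configuration on a conic through the coordinate points, with coefficients of the
same sign, is a limit of positive ones. -/
theorem mem_closure_of_quadric {n : ℕ} {u : Fin n → Fin 3 → ℝ} (hN : TNonneg u)
    (hpos : ∃ i j k, i < j ∧ j < k ∧ 0 < det3 (u i) (u j) (u k)) {A B C : ℝ}
    (hA : 0 < A) (hB : 0 < B) (hC : 0 < C)
    (hQ : ∀ i, A * (u i 1 * u i 2) + B * (u i 0 * u i 2) + C * (u i 0 * u i 1) = 0)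
    (h0 : ∀ i, 0 ≤ u i 0 / A + u i 2 / C) (h1 : ∀ i, 0 ≤ u i 1 / B + u i 2 / C) :
    u ∈ closure (posConic n) := by
  -- With `X = x / A`, `Y = y / B`, `Z = z / C` the equation is `XY + XZ + YZ = 0`, that is `(X + Z)
  -- (Y + Z) = (-Z) ^ 2`.
  have hex : ∀ i, ∃ a b, ![u i 0 / A + u i 2 / C, -(u i 2 / C), u i 1 / B + u i 2 / C] =
      ver a b := by
    intro i
    obtain ⟨a, b, h⟩ := exists_ver (s := 1) one_pos
      (w := ![u i 0 / A + u i 2 / C, -(u i 2 / C), u i 1 / B + u i 2 / C])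
      (by simpa using h0 i) (by simpa using h1 i) (by
        simp
        field_simp
        linear_combination C * hQ i)
    refine ⟨a, b, ?_⟩
    rw [h]
    ext r
    rw [Matrix.mulVec_diagonal]
    fin_cases r <;> simp
  choose a b hab using hex
  refine mem_closure_of_eq_mulVec_ver hN hpos
    (g := !![A, A, 0; 0, B, B; 0, -C, 0]) (a := a) (b := b) ?_ fun i => ?_
  · rw [Matrix.det_fin_three]
    simp
    positivity
  · rw [← hab]
    ext r
    fin_cases r <;> simp [Matrix.mulVec, dotProduct, Fin.sum_univ_three] <;> field_simp <;> ring

/-- The signs of the coordinates with respect to three of the vectors. -/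
theorem TNonneg.coord_signs {n : ℕ} {u : Fin n → Fin 3 → ℝ} (hN : TNonneg u) {j₁ j₂ j₃ : Fin n}
    (h12 : j₁ < j₂) (h23 : j₂ < j₃) (h1 : u j₁ = ![1, 0, 0]) (h2 : u j₂ = ![0, 1, 0])
    (h3 : u j₃ = ![0, 0, 1]) {i : Fin n} (hx : u i 0 ≠ 0) (hy : u i 1 ≠ 0) (hz : u i 2 ≠ 0) :
    (Cyc j₁ i j₂ ∧ 0 < u i 0 ∧ 0 < u i 1 ∧ u i 2 < 0) ∨
    (Cyc j₂ i j₃ ∧ u i 0 < 0 ∧ 0 < u i 1 ∧ 0 < u i 2) ∨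
    (Cyc j₃ i j₁ ∧ 0 < u i 0 ∧ u i 1 < 0 ∧ 0 < u i 2) := by
  have n1 : i ≠ j₁ := by rintro rfl; simp [h1] at hy
  have n2 : i ≠ j₂ := by rintro rfl; simp [h2] at hx
  have n3 : i ≠ j₃ := by rintro rfl; simp [h3] at hx
  have d1 : det3 (u i) (u j₂) (u j₃) = u i 0 := by simp [det3, h2, h3]
  have d2 : det3 (u j₁) (u i) (u j₃) = u i 1 := by simp [det3, h1, h3]
  have d3 : det3 (u j₁) (u j₂) (u i) = u i 2 := by simp [det3, h1, h2]
  have e1 : det3 (u j₂) (u i) (u j₃) = -u i 0 := by simp [det3, h2, h3]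
  have e2 : det3 (u j₁) (u j₃) (u i) = -u i 1 := by simp [det3, h1, h3]
  have e3 : det3 (u j₁) (u i) (u j₂) = -u i 2 := by simp [det3, h1, h2]
  have hc : (Cyc j₁ i j₂ ∧ Cyc i j₂ j₃ ∧ Cyc j₁ i j₃) ∨ (Cyc j₂ i j₃ ∧ Cyc j₁ i j₃ ∧ Cyc j₁ j₂ i) ∨
      (Cyc j₃ i j₁ ∧ Cyc i j₂ j₃ ∧ Cyc j₁ j₂ i ∧ Cyc j₁ j₃ i) := by unfold Cyc; omega
  rcases hc with ⟨c1, c2, c3⟩ | ⟨c1, c2, c3⟩ | ⟨c1, c2, c3, c4⟩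
  · left
    have f1 := hN.cyc c1
    have f2 := hN.cyc c2
    have f3 := hN.cyc c3
    rw [e3] at f1; rw [d1] at f2; rw [d2] at f3
    exact ⟨c1, lt_of_le_of_ne f2 hx.symm, lt_of_le_of_ne f3 hy.symm,
      lt_of_le_of_ne (by linarith) hz⟩
  · right; left
    have f1 := hN.cyc c1
    have f2 := hN.cyc c2
    have f3 := hN.cyc c3
    rw [e1] at f1; rw [d2] at f2; rw [d3] at f3
    exact ⟨c1, lt_of_le_of_ne (by linarith) hx, lt_of_le_of_ne f2 hy.symm,
      lt_of_le_of_ne f3 hz.symm⟩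
  · right; right
    have f2 := hN.cyc c2
    have f3 := hN.cyc c3
    have f4 := hN.cyc c4
    rw [d1] at f2; rw [d3] at f3; rw [e2] at f4
    exact ⟨c1, lt_of_le_of_ne f2 hx.symm, lt_of_le_of_ne (by linarith) hy,
      lt_of_le_of_ne f3 hz.symm⟩

theorem TNonneg.sign_det3 {n : ℕ} {u : Fin n → Fin 3 → ℝ} (hN : TNonneg u) {i j k : Fin n}
    (h : det3 (u i) (u j) (u k) ≠ 0) :
    (Cyc i j k ∧ SignType.sign (det3 (u i) (u j) (u k)) = 1) ∨
      (Cyc i k j ∧ SignType.sign (det3 (u i) (u j) (u k)) = -1) := by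
  rcases lt_or_gt_of_ne h with h | h
  · exact Or.inr ⟨hN.cyc_of_neg h, sign_neg h⟩
  · exact Or.inl ⟨hN.cyc_of_pos h, sign_pos h⟩

/-- A nonnegative configuration on a conic which contains five vectors in general position is a
limit of positive ones. -/
theorem mem_closure_of_five {n : ℕ} {u : Fin n → Fin 3 → ℝ} (hN : TNonneg u) (hS : SixRel u)
    {j₁ j₂ j₃ p q : Fin n} (h12 : j₁ < j₂) (h23 : j₂ < j₃) (h1 : u j₁ = ![1, 0, 0])
    (h2 : u j₂ = ![0, 1, 0]) (h3 : u j₃ = ![0, 0, 1])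
    (hp : ∀ r, u p r ≠ 0) (hq : ∀ r, u q r ≠ 0)
    (hd1 : det3 (u j₁) (u p) (u q) ≠ 0) (hd2 : det3 (u j₂) (u p) (u q) ≠ 0)
    (hd3 : det3 (u j₃) (u p) (u q) ≠ 0)
    (hu : ∀ i, (∀ r, u i r ≠ 0) ∨ ∃ c : ℝ, 0 ≤ c ∧ ∃ r, u i = Pi.single r c) :
    u ∈ closure (posConic n) := by
  set A := det3 (u j₁) (u p) (u q) * (u p 0 * u q 0) with hA
  set B := det3 (u j₂) (u p) (u q) * (u p 1 * u q 1) with hB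
  set C := det3 (u j₃) (u p) (u q) * (u p 2 * u q 2) with hC
  -- The six-point relation with five points fixed is the equation of the conic through them in the
  -- sixth.
  have hQ : ∀ i, A * (u i 1 * u i 2) + B * (u i 0 * u i 2) + C * (u i 0 * u i 1) = 0 := by
    intro i
    have := hS j₁ j₂ j₃ p q i
    simp only [hA, hB, hC]
    simp [det3, h1, h2, h3] at this ⊢
    linear_combination -this
  -- All the signs are governed by the cyclic positions of `p` and `q` among `j₁, j₂, j₃`; every
  -- sign pattern compatible with some position gives equal signs.
  have hsign : SignType.sign A = SignType.sign B ∧ SignType.sign B = SignType.sign C ∧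
      SignType.sign A ≠ 0 := by
    have t1 := hN.sign_det3 hd1
    have t2 := hN.sign_det3 hd2
    have t3 := hN.sign_det3 hd3
    have tp := hN.coord_signs h12 h23 h1 h2 h3 (hp 0) (hp 1) (hp 2)
    have tq := hN.coord_signs h12 h23 h1 h2 h3 (hq 0) (hq 1) (hq 2)
    simp only [hA, hB, hC, sign_mul]
    generalize SignType.sign (det3 (u j₁) (u p) (u q)) = s1 at *
    generalize SignType.sign (det3 (u j₂) (u p) (u q)) = s2 at *
    generalize SignType.sign (det3 (u j₃) (u p) (u q)) = s3 at *
    clear hd1 hd2 hd3 hA hB hC hQ hN hS hu hp hq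
    rcases tp with ⟨cp, px, py, pz⟩ | ⟨cp, px, py, pz⟩ | ⟨cp, px, py, pz⟩ <;>
    rcases tq with ⟨cq, qx, qy, qz⟩ | ⟨cq, qx, qy, qz⟩ | ⟨cq, qx, qy, qz⟩ <;>
    simp only [sign_pos, sign_neg, px, py, pz, qx, qy, qz] <;>
    clear px py pz qx qy qz <;>
    rcases t1 with ⟨c1, rfl⟩ | ⟨c1, rfl⟩ <;>
    rcases t2 with ⟨c2, rfl⟩ | ⟨c2, rfl⟩ <;>
    rcases t3 with ⟨c3, rfl⟩ | ⟨c3, rfl⟩ <;>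
    first
    | decide
    | (exfalso; unfold Cyc at *; omega)
  have hpos : ∃ i j k, i < j ∧ j < k ∧ 0 < det3 (u i) (u j) (u k) :=
    ⟨j₁, j₂, j₃, h12, h23, by simp [det3, h1, h2, h3]⟩
  have main : ∀ A B C : ℝ, 0 < A → 0 < B → 0 < C →
      (∀ i, A * (u i 1 * u i 2) + B * (u i 0 * u i 2) + C * (u i 0 * u i 1) = 0) →
      u ∈ closure (posConic n) := by
    intro A B C hA hB hC hQ
    have key : ∀ i, 0 ≤ u i 0 / A + u i 2 / C ∧ 0 ≤ u i 1 / B + u i 2 / C := by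
      intro i
      rcases hu i with h | ⟨c, hc, r, hr⟩
      · have hQ' : u i 1 / B * (u i 2 / C) + u i 0 / A * (u i 2 / C) + u i 0 / A * (u i 1 / B)
            = 0 := by
          field_simp; linear_combination hQ i
        have hx : ∀ {x y : ℝ}, 0 < y → (0 < x → 0 < x / y) ∧ (x < 0 → x / y < 0) :=
          fun hy => ⟨fun hx => div_pos hx hy, fun hx => div_neg_of_neg_of_pos hx hy⟩
        have hx0 := hx (x := u i 0) hA
        have hx1 := hx (x := u i 1) hB
        have hx2 := hx (x := u i 2) hC
        generalize u i 0 / A = X at *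
        generalize u i 1 / B = Y at *
        generalize u i 2 / C = Z at *
        rcases hN.coord_signs h12 h23 h1 h2 h3 (h 0) (h 1) (h 2) with
          ⟨-, a0, a1, a2⟩ | ⟨-, a0, a1, a2⟩ | ⟨-, a0, a1, a2⟩
        · have b0 := hx0.1 a0; have b1 := hx1.1 a1; have b2 := hx2.2 a2
          exact ⟨nonneg_of_mul_nonneg_right (a := Y) (by nlinarith) b1,
            nonneg_of_mul_nonneg_right (a := X) (by nlinarith) b0⟩
        · have b0 := hx0.2 a0; have b1 := hx1.1 a1; have b2 := hx2.1 a2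
          exact ⟨nonneg_of_mul_nonneg_right (a := Y) (by nlinarith) b1, by linarith⟩
        · have b0 := hx0.1 a0; have b1 := hx1.2 a1; have b2 := hx2.1 a2
          exact ⟨by linarith, nonneg_of_mul_nonneg_right (a := X) (by nlinarith) b0⟩
      · rw [hr]
        fin_cases r <;> simp <;> try constructor
        all_goals positivity
    exact mem_closure_of_quadric hN hpos hA hB hC hQ (fun i => (key i).1) (fun i => (key i).2)
  obtain ⟨s1, s2, s3⟩ := hsign
  rcases lt_trichotomy A 0 with h | h | h
  · rw [sign_neg h] at s1
    rw [← s1] at s2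
    exact main (-A) (-B) (-C) (by linarith) (by linarith [sign_eq_neg_one_iff.1 s1.symm])
      (by linarith [sign_eq_neg_one_iff.1 s2.symm]) fun i => by linear_combination -hQ i
  · exact (s3 (by rw [h, sign_zero])).elim
  · rw [sign_pos h] at s1
    rw [← s1] at s2
    exact main A B C h (sign_eq_one_iff.1 s1.symm) (sign_eq_one_iff.1 s2.symm) hQ

/-! ### Case analysis on the directions: opposite, coplanar, few. -/

section

variable {n : ℕ} {v : Fin n → Fin 3 → ℝ}

/-- Configurations with two opposite vectors. -/
theorem mem_closure_of_opposite (hN : TNonneg v)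
    (hpos : ∃ i j k, i < j ∧ j < k ∧ 0 < det3 (v i) (v j) (v k)) {i j : Fin n} {μ : ℝ}
    (hμ : 0 < μ) (hi : v i ≠ 0) (hij : v j = -μ • v i) : v ∈ closure (posConic n) := by
  have hj : v j ≠ 0 := by
    rw [hij]; exact smul_ne_zero (neg_ne_zero.2 hμ.ne') hi
  have hne : i ≠ j := by
    rintro rfl
    apply hi
    have : (1 + μ) • v i = 0 := by
      rw [add_smul, one_smul]; nth_rewrite 1 [hij]; rw [neg_smul, neg_add_cancel]
    exact (smul_eq_zero.1 this).resolve_left (by positivity)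
  have hi' : v i = -(1 / μ) • v j := by
    rw [hij, smul_smul]; field_simp; simp
  -- For `k, k'` between `i` and `j`, the minors with `v i` and with `v j` are both nonnegative but
  -- differ by the factor `-μ`, so they vanish. Each arc between `i` and `j` thus spans at most a
  -- plane through `v j`.
  have hK : ∀ k k', Cyc i k j → Cyc i k' j → det3 (v k) (v j) (v k') = 0 := by
    have key : ∀ k k', Cyc i k k' → Cyc k k' j → det3 (v k) (v j) (v k') = 0 := by
      intro k k' h1 h2
      have e1 := hN.cyc h1
      have e2 := hN.cyc h2
      have e3 : det3 (v k) (v k') (v j) = -μ * det3 (v i) (v k) (v k') := by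
        rw [hij, det3_smul_right, det3_rotate]
      rw [det3_swap_right, neg_eq_zero]
      apply le_antisymm _ e2
      rw [e3]
      nlinarith
    intro k k' h1 h2
    by_cases hkk : k = k'
    · subst hkk; simp
    · have : (Cyc i k k' ∧ Cyc k k' j) ∨ (Cyc i k' k ∧ Cyc k' k j) := by unfold Cyc at *; omega
      rcases this with h | h
      · exact key k k' h.1 h.2
      · have := key k' k h.1 h.2
        rw [← det3_rotate, det3_swap_left, this, neg_zero]
  have hL : ∀ k k', Cyc i j k → Cyc i j k' → det3 (v j) (v k) (v k') = 0 := by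
    have key : ∀ k k', Cyc j k k' → Cyc k k' i → det3 (v j) (v k) (v k') = 0 := by
      intro k k' h1 h2
      have e1 := hN.cyc h1
      have e2 := hN.cyc h2
      have e3 : det3 (v j) (v k) (v k') = -μ * det3 (v k) (v k') (v i) := by
        rw [hij, det3_smul_left, ← det3_rotate]
      apply le_antisymm _ e1
      rw [e3]
      nlinarith
    intro k k' h1 h2
    by_cases hkk : k = k'
    · subst hkk; simp
    · have : (Cyc j k k' ∧ Cyc k k' i) ∨ (Cyc j k' k ∧ Cyc k' k i) := by unfold Cyc at *; omega
      rcases this with h | h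
      · exact key k k' h.1 h.2
      · rw [det3_swap_right, key k' k h.1 h.2, neg_zero]
  have hex : ∃ m m', det3 (v m) (v j) (v m') ≠ 0 := by
    obtain ⟨a, b, c, -, -, habc⟩ := hpos
    by_contra! h
    apply hj
    refine eq_zero_of_det3 habc.ne' ?_ (h a c) ?_
    · rw [det3_swap_left, h b c, neg_zero]
    · rw [det3_swap_right, h a b, neg_zero]
  have hside : ∀ m w, det3 (v m) (v j) w ≠ 0 → Cyc i m j ∨ Cyc i j m := by
    intro m w hm
    apply cyc_or_cyc
    · rintro rfl; apply hm; rw [hi', det3_smul_left]; simp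
    · rintro rfl; apply hm; simp
    · exact hne
  obtain ⟨k, l, hk, hl, hkl⟩ : ∃ k l, Cyc i k j ∧ Cyc i j l ∧ det3 (v k) (v j) (v l) ≠ 0 := by
    obtain ⟨m, m', hm⟩ := hex
    have s1 := hside m _ hm
    have s2 := hside m' (v m) (fun h => hm (by unfold det3 at *; linarith))
    rcases s1 with s1 | s1 <;> rcases s2 with s2 | s2
    · exact (hm (hK m m' s1 s2)).elim
    · exact ⟨m, m', s1, s2, hm⟩
    · exact ⟨m', m, s2, s1, fun h => hm (by unfold det3 at *; linarith)⟩
    · exact (hm (by rw [det3_swap_left, hL m m' s1 s2, neg_zero])).elim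
  have hcases : ∀ m, ((∃ c : ℝ, v m = c • v j) ∨ Cyc i m j) ∨ Cyc i j m := by
    intro m
    by_cases h1 : m = i
    · exact Or.inl (Or.inl ⟨-(1 / μ), by rw [h1, hi']⟩)
    by_cases h2 : m = j
    · exact Or.inl (Or.inl ⟨1, by rw [h2, one_smul]⟩)
    · rcases cyc_or_cyc (Ne.symm h1) h2 hne with h | h
      · exact Or.inl (Or.inr h)
      · exact Or.inr h
  have hfK : ∀ m, ((∃ c : ℝ, v m = c • v j) ∨ Cyc i m j) → det3 (v k) (v j) (v m) = 0 := by
    rintro m (⟨c, hc⟩ | hm)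
    · rw [hc, det3_smul_right]; simp
    · exact hK k m hk hm
  refine mem_closure_of_wedge hN hpos (a := v k) (b := v j) (c := v j) (d := v l)
    ⟨v l, hkl⟩ ⟨v k, by rwa [det3_rotate]⟩ (fun m => ?_) (fun m => ?_) (fun m => ?_)
  · rcases hcases m with h | h
    · exact (hfK m h).ge
    · apply hN.cyc; unfold Cyc at *; omega
  · rcases hcases m with (⟨c, hc⟩ | h) | h
    · rw [hc, det3_smul_right]; simp
    · apply hN.cyc; unfold Cyc at *; omega
    · exact (hL l m hl h).ge
  · rcases hcases m with h | h
    · rw [hfK m h, zero_mul]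
    · rw [hL l m hl h, mul_zero]

/-- Two vectors of a plane with at least three directions do not separate the vectors off the
plane. -/
theorem TNonneg.not_separated (hN : TNonneg v) {a b c l m : Fin n}
    (habc : det3 (v a) (v b) (v c) = 0) (hac : Indep (v a) (v c)) (hbc : Indep (v b) (v c))
    (hl : 0 < det3 (v a) (v b) (v l)) (hm : det3 (v a) (v b) (v m) < 0) : False := by
  have e1 := det3_pluecker (v b) (v a) (v c) (v l) (v m)
  have e2 := det3_pluecker (v a) (v b) (v c) (v l) (v m)
  have hbac : det3 (v b) (v a) (v c) = 0 := by rw [det3_swap_left, habc, neg_zero]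
  rw [habc, zero_mul] at e1
  rw [hbac, zero_mul] at e2
  have n1 := hbc.det3_ne_zero habc hl.ne'
  have n2 := hac.det3_ne_zero hbac (l := v l) (by
    rw [det3_swap_left]; exact (neg_neg_of_pos hl).ne)
  rw [det3_swap_left (v a) (v b) (v m), det3_swap_left (v a) (v b) (v l)] at e2
  have c1 := hN.cyc_of_pos hl
  have c2 := hN.cyc_of_neg hm
  -- The Plücker relations give `l` and `m` opposite signs for the pairs `b c` and `a c` too. Three
  -- points on a circle cannot have each of their pairs separate the same two points.
  have h1 : (Cyc b c l ∧ Cyc b m c) ∨ (Cyc b l c ∧ Cyc b c m) := by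
    rcases lt_or_gt_of_ne n1 with h | h
    · exact Or.inr ⟨hN.cyc_of_neg h, hN.cyc_of_pos (by nlinarith)⟩
    · exact Or.inl ⟨hN.cyc_of_pos h, hN.cyc_of_neg (by nlinarith)⟩
  have h2 : (Cyc a c l ∧ Cyc a m c) ∨ (Cyc a l c ∧ Cyc a c m) := by
    rcases lt_or_gt_of_ne n2 with h | h
    · exact Or.inr ⟨hN.cyc_of_neg h, hN.cyc_of_pos (by nlinarith)⟩
    · exact Or.inl ⟨hN.cyc_of_pos h, hN.cyc_of_neg (by nlinarith)⟩
  unfold Cyc at *; omega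

theorem det3_plane (a b l p q t : Fin 3 → ℝ) :
    det3 a b l * det3 p q t - det3 a b t * det3 p q l =
      det3 a b q * det3 p l t - det3 a b p * det3 q l t := by
  unfold det3; ring

theorem det3_eq_zero_of_plane {a b p q r : Fin 3 → ℝ} (hab : Indep a b) (hp : det3 a b p = 0)
    (hq : det3 a b q = 0) (hr : det3 a b r = 0) : det3 p q r = 0 := by
  obtain ⟨l, hl⟩ := hab
  have := det3_plane a b l p q r
  rw [hp, hq, hr] at this
  simpa [hl] using this

theorem det3_ne_zero_of_plane {a b l p q : Fin 3 → ℝ} (hp : det3 a b p = 0)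
    (hq : det3 a b q = 0) (hl : det3 a b l ≠ 0) (hpq : Indep p q) : det3 p q l ≠ 0 := by
  intro h
  obtain ⟨t, ht⟩ := hpq
  have := det3_plane a b l p q t
  rw [hp, hq, h] at this
  simp [hl, ht] at this

/-- Among three directions, one differs from two given ones. -/
theorem exists_indep_of_three {a b c p q : Fin 3 → ℝ} (hab : Indep a b) (hac : Indep a c)
    (hbc : Indep b c) (hp : p ≠ 0) (hq : q ≠ 0) :
    (Indep p a ∧ Indep q a) ∨ (Indep p b ∧ Indep q b) ∨ (Indep p c ∧ Indep q c) := by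
  have key : ∀ {p x y : Fin 3 → ℝ}, p ≠ 0 → Indep x y → Indep p x ∨ Indep p y := by
    intro p x y hp hxy
    by_contra! h
    obtain ⟨r, rfl⟩ := exists_smul_of_not_indep hp h.1
    obtain ⟨s, rfl⟩ := exists_smul_of_not_indep hp h.2
    obtain ⟨t, ht⟩ := hxy
    rw [det3_smul_left, det3_smul_mid] at ht
    simp at ht
  have p1 := key hp hab
  have p2 := key hp hac
  have p3 := key hp hbc
  have q1 := key hq hab
  have q2 := key hq hac
  have q3 := key hq hbc
  tauto

/-- Two vectors in the plane of `a`, `b`, `c` do not separate the vectors off it. -/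
theorem TNonneg.not_separated_of_plane (hN : TNonneg v) {a b c p q l m : Fin n}
    (habc : det3 (v a) (v b) (v c) = 0) (hab : Indep (v a) (v b)) (hac : Indep (v a) (v c))
    (hbc : Indep (v b) (v c)) (hp : det3 (v a) (v b) (v p) = 0) (hq : det3 (v a) (v b) (v q) = 0)
    (hpq : Indep (v p) (v q))
    (hl : 0 < det3 (v p) (v q) (v l)) (hm : det3 (v p) (v q) (v m) < 0) : False := by
  rcases exists_indep_of_three hab hac hbc hpq.ne_zero hpq.symm.ne_zero with h | h | h
  · exact hN.not_separated (det3_eq_zero_of_plane hab hp hq (by simp)) h.1 h.2 hl hm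
  · exact hN.not_separated (det3_eq_zero_of_plane hab hp hq (by simp)) h.1 h.2 hl hm
  · exact hN.not_separated (det3_eq_zero_of_plane hab hp hq habc) h.1 h.2 hl hm

/-- A conic with three collinear points splits into two lines: one side of the six-point relation
vanishes, and on the other side only the minor of `l m k` can be zero. -/
theorem SixRel.det3_eq_zero (hS : SixRel v) {a b c l m k : Fin n}
    (habc : det3 (v a) (v b) (v c) = 0) (hac : Indep (v a) (v c))
    (hbc : Indep (v b) (v c)) (hl : det3 (v a) (v b) (v l) ≠ 0)
    (hm : det3 (v a) (v b) (v m) ≠ 0) (hk : det3 (v a) (v b) (v k) ≠ 0) :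
    det3 (v l) (v m) (v k) = 0 := by
  have := hS a b c l m k
  rw [habc] at this
  simp only [zero_mul] at this
  have h1 := det3_ne_zero_of_plane (by simp) habc hm hac
  have h2 := det3_ne_zero_of_plane (by simp) habc hk hbc
  simpa [hl, h1, h2] using this.symm

/-- Configurations with three coplanar directions and no opposite vectors. -/
theorem mem_closure_of_coplanar (hN : TNonneg v) (hS : SixRel v)
    (hpos : ∃ i j k, i < j ∧ j < k ∧ 0 < det3 (v i) (v j) (v k))
    (hopp : ∀ i j, v i ≠ 0 → v j ≠ 0 → ¬ Indep (v i) (v j) → ∃ c : ℝ, 0 < c ∧ v j = c • v i)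
    {a b c : Fin n} (habc : det3 (v a) (v b) (v c) = 0) (hab : Indep (v a) (v b))
    (hac : Indep (v a) (v c)) (hbc : Indep (v b) (v c)) : v ∈ closure (posConic n) := by
  obtain ⟨i₀, j₀, k₀, hij₀, hjk₀, h₀⟩ := id hpos
  obtain ⟨l, -, hl⟩ := exists_det3_ne_zero h₀.ne' hab
  wlog hl' : 0 < det3 (v a) (v b) (v l) generalizing a b
  · refine this (a := b) (b := a) ?_ hab.symm hbc hac ?_ ?_
    · rw [det3_swap_left, habc, neg_zero]
    · rw [det3_swap_left]; exact neg_ne_zero.2 hl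
    · rw [det3_swap_left]; exact neg_pos.2 (lt_of_le_of_ne (not_lt.1 hl') hl)
  have hf : ∀ m, 0 ≤ det3 (v a) (v b) (v m) := by
    intro m
    by_contra! hm
    exact hN.not_separated habc hac hbc hl' hm
  by_cases hoff : ∃ l₁ l₂, det3 (v a) (v b) (v l₁) ≠ 0 ∧ det3 (v a) (v b) (v l₂) ≠ 0 ∧
      Indep (v l₁) (v l₂)
  · obtain ⟨l₁, l₂, h1, h2, h12⟩ := hoff
    have hz : ∀ m, det3 (v a) (v b) (v m) ≠ 0 → det3 (v l₁) (v l₂) (v m) = 0 := fun m hm =>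
      hS.det3_eq_zero habc hac hbc h1 h2 hm
    -- Vectors `p, q` on opposite sides of the second plane would separate `l₁` from `l₂`
    -- cyclically. Nonnegativity then puts `l₁` and `l₂` on opposite sides of the plane of `p, q`,
    -- which is the first plane.
    have hsgn : ∀ p q, 0 < det3 (v l₁) (v l₂) (v p) → det3 (v l₁) (v l₂) (v q) < 0 → False := by
      intro p q hp hq
      have hp0 : det3 (v a) (v b) (v p) = 0 := by
        by_contra h; exact hp.ne' (hz p h)
      have hq0 : det3 (v a) (v b) (v q) = 0 := by
        by_contra h; exact hq.ne (hz q h)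
      have hpn : v p ≠ 0 := by intro h; simp [h, det3] at hp
      have hqn : v q ≠ 0 := by intro h; simp [h, det3] at hq
      by_cases hpq : Indep (v p) (v q)
      · have c1 := hN.cyc_of_pos hp
        have c2 := hN.cyc_of_neg hq
        have n1 := det3_ne_zero_of_plane hp0 hq0 h1 hpq
        have n2 := det3_ne_zero_of_plane hp0 hq0 h2 hpq
        have c3 : Cyc p l₁ q ∧ Cyc p q l₂ := by unfold Cyc at *; omega
        have g1 := hN.cyc c3.1
        rw [det3_swap_right] at g1
        exact hN.not_separated_of_plane habc hab hac hbc hp0 hq0 hpq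
          (lt_of_le_of_ne (hN.cyc c3.2) n2.symm) (lt_of_le_of_ne (by linarith) n1)
      · obtain ⟨r, hr, hrq⟩ := hopp p q hpn hqn hpq
        rw [hrq, det3_smul_right] at hq
        nlinarith
    by_cases hneg : ∃ q, det3 (v l₁) (v l₂) (v q) < 0
    · obtain ⟨q, hq⟩ := hneg
      refine mem_closure_of_wedge hN hpos hab h12.symm hf (fun m => ?_) fun m => ?_
      · rw [det3_swap_left]
        by_contra! hm
        exact hsgn m q (by linarith) hq
      · by_cases hm : det3 (v a) (v b) (v m) = 0
        · rw [hm, zero_mul]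
        · rw [det3_swap_left (v l₁), hz m hm, neg_zero, mul_zero]
    · push Not at hneg
      refine mem_closure_of_wedge hN hpos hab h12 hf hneg fun m => ?_
      by_cases hm : det3 (v a) (v b) (v m) = 0
      · rw [hm, zero_mul]
      · rw [hz m hm, mul_zero]
  · push Not at hoff
    classical
    have hFne : (Finset.univ.filter fun m => v m ≠ 0 ∧ det3 (v a) (v b) (v m) = 0).Nonempty :=
      ⟨a, by simp [hab.ne_zero]⟩
    -- The vectors off the plane are now all parallel to `v l`. The key adds `n` to indices below
    -- `l`, so `w` is the last nonzero vector of the plane cyclically before `l`, and the plane of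
    -- `w, l` has the others on one side.
    obtain ⟨w, hw, hmax⟩ := Finset.exists_max_image _
      (fun m : Fin n => if m < l then (m : ℕ) + n else m) hFne
    simp only [Finset.mem_filter, Finset.mem_univ, true_and] at hw hmax
    have hln : v l ≠ 0 := by intro h; simp [h, det3] at hl
    have hwl : Indep (v w) (v l) := by
      by_contra h
      obtain ⟨r, hr⟩ := exists_smul_of_not_indep hw.1 h
      rw [hr, det3_smul_right, hw.2, mul_zero] at hl
      exact hl rfl
    have hoffl : ∀ m, det3 (v a) (v b) (v m) ≠ 0 → det3 (v w) (v l) (v m) = 0 := by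
      intro m hm
      obtain ⟨r, hr⟩ := exists_smul_of_not_indep hln (hoff l m hl hm)
      rw [hr, det3_smul_right, det3_self_right, mul_zero]
    refine mem_closure_of_wedge hN hpos hab hwl hf (fun m => ?_) fun m => ?_
    · by_cases hm : det3 (v a) (v b) (v m) = 0
      · by_cases hm0 : v m = 0
        · simp [hm0, det3]
        by_cases hmw : m = w
        · simp [hmw]
        have h1 := hmax m ⟨hm0, hm⟩
        apply hN.cyc
        have hml : m ≠ l := by rintro rfl; exact hl hm
        have hwl' : w ≠ l := by rintro rfl; exact hl hw.2
        have := m.2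
        have := w.2
        unfold Cyc
        split_ifs at h1 <;> omega
      · exact (hoffl m hm).ge
    · by_cases hm : det3 (v a) (v b) (v m) = 0
      · rw [hm, zero_mul]
      · rw [hoffl m hm, mul_zero]

/-- Configurations with at most four directions, in cyclic order. -/
theorem mem_closure_of_four (hN : TNonneg v)
    (hpos : ∃ i j k, i < j ∧ j < k ∧ 0 < det3 (v i) (v j) (v k)) {i j k l : Fin n}
    (h1 : 0 < det3 (v i) (v j) (v k)) (h2 : 0 < det3 (v i) (v j) (v l))
    (h3 : 0 < det3 (v i) (v k) (v l)) (h4 : 0 < det3 (v j) (v k) (v l))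
    (h : ∀ m, ∃ c : ℝ, 0 ≤ c ∧ (v m = c • v i ∨ v m = c • v j ∨ v m = c • v k ∨ v m = c • v l)) :
    v ∈ closure (posConic n) := by
  rw [← det3_rotate] at h3 h4
  refine mem_closure_of_wedge hN hpos ⟨_, h1.ne'⟩ ⟨_, h3.ne'⟩ (fun m => ?_) (fun m => ?_)
    fun m => ?_
  all_goals
    obtain ⟨c, hc, hm | hm | hm | hm⟩ := h m <;> rw [hm] <;> simp only [det3_smul_right] <;>
    first | positivity | simp

theorem mem_closure_of_three (hN : TNonneg v)
    (hpos : ∃ i j k, i < j ∧ j < k ∧ 0 < det3 (v i) (v j) (v k)) {i j k : Fin n}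
    (h1 : 0 < det3 (v i) (v j) (v k))
    (h : ∀ m, ∃ c : ℝ, 0 ≤ c ∧ (v m = c • v i ∨ v m = c • v j ∨ v m = c • v k)) :
    v ∈ closure (posConic n) := by
  have h2 := h1
  rw [← det3_rotate] at h2
  refine mem_closure_of_wedge hN hpos ⟨_, h1.ne'⟩ ⟨_, h2.ne'⟩ (fun m => ?_) (fun m => ?_)
    fun m => ?_
  all_goals
    obtain ⟨c, hc, hm | hm | hm⟩ := h m <;> rw [hm] <;> simp only [det3_smul_right] <;>
    first | positivity | simp

end

section

variable {n : ℕ} {v : Fin n → Fin 3 → ℝ}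

theorem SixRel.mulVec (hS : SixRel v) (h : Matrix (Fin 3) (Fin 3) ℝ) :
    SixRel fun i => h.mulVec (v i) := by
  intro a b c d e f
  simp only [det3_mulVec]
  linear_combination h.det ^ 4 * hS a b c d e f

/-- A configuration in which any three directions are independent, with five directions. -/
theorem mem_closure_of_general (hN : TNonneg v) (hS : SixRel v)
    (hopp : ∀ i j, v i ≠ 0 → v j ≠ 0 → ¬ Indep (v i) (v j) → ∃ c : ℝ, 0 < c ∧ v j = c • v i)
    (hgen : ∀ a b c, Indep (v a) (v b) → Indep (v a) (v c) → Indep (v b) (v c) →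
      det3 (v a) (v b) (v c) ≠ 0) {i j k p q : Fin n} (hij : i < j) (hjk : j < k)
    (hijk : 0 < det3 (v i) (v j) (v k))
    (hp : Indep (v i) (v p) ∧ Indep (v j) (v p) ∧ Indep (v k) (v p))
    (hq : Indep (v i) (v q) ∧ Indep (v j) (v q) ∧ Indep (v k) (v q)) (hpq : Indep (v p) (v q)) :
    v ∈ closure (posConic n) := by
  have nij : Indep (v i) (v j) := ⟨_, hijk.ne'⟩
  have njk : Indep (v j) (v k) := ⟨v i, by rw [det3_rotate]; exact hijk.ne'⟩
  have nik : Indep (v i) (v k) :=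
    ⟨v j, by rw [det3_swap_right]; exact neg_ne_zero.2 hijk.ne'⟩
  set E : Matrix (Fin 3) (Fin 3) ℝ := (Matrix.of ![v i, v j, v k]).transpose with hE
  have hEdet : E.det = det3 (v i) (v j) (v k) := by
    rw [hE, Matrix.det_transpose, Matrix.det_fin_three]
    simp [det3]; ring
  have hEu : IsUnit E.det := by rw [hEdet]; exact isUnit_iff_ne_zero.2 hijk.ne'
  set h := E⁻¹ with hh
  have hhdet : 0 < h.det := by
    rw [hh, Matrix.det_nonsing_inv, Ring.inverse_eq_inv', hEdet]; positivity
  have hcol : ∀ r, h.mulVec (E.mulVec (Pi.single r 1)) = Pi.single r 1 := by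
    intro r
    rw [Matrix.mulVec_mulVec, hh, Matrix.nonsing_inv_mul _ hEu, Matrix.one_mulVec]
  have hi' : h.mulVec (v i) = Pi.single 0 1 := by
    rw [← hcol 0]; congr 1; ext r; simp [hE]
  have hj' : h.mulVec (v j) = Pi.single 1 1 := by
    rw [← hcol 1]; congr 1; ext r; simp [hE]
  have hk' : h.mulVec (v k) = Pi.single 2 1 := by
    rw [← hcol 2]; congr 1; ext r; simp [hE]
  have s0 : (Pi.single 0 1 : Fin 3 → ℝ) = ![1, 0, 0] := by ext r; fin_cases r <;> simp
  have s1 : (Pi.single 1 1 : Fin 3 → ℝ) = ![0, 1, 0] := by ext r; fin_cases r <;> simp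
  have s2 : (Pi.single 2 1 : Fin 3 → ℝ) = ![0, 0, 1] := by ext r; fin_cases r <;> simp
  have hne : ∀ m, Indep (v i) (v m) → Indep (v j) (v m) → Indep (v k) (v m) →
      ∀ r, h.mulVec (v m) r ≠ 0 := by
    intro m h1 h2 h3 r
    have d0 := det3_mulVec h (v m) (v j) (v k)
    have d1 := det3_mulVec h (v i) (v m) (v k)
    have d2 := det3_mulVec h (v i) (v j) (v m)
    have g0 := mul_ne_zero hhdet.ne' (hgen m j k h2.symm h3.symm njk)
    have g1 := mul_ne_zero hhdet.ne' (hgen i m k h1 nik h3.symm)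
    have g2 := mul_ne_zero hhdet.ne' (hgen i j m nij h1 h2)
    rw [← d0, hj', hk', s1, s2] at g0
    rw [← d1, hi', hk', s0, s2] at g1
    rw [← d2, hi', hj', s0, s1] at g2
    simp [det3] at g0 g1 g2
    fin_cases r
    · exact g0
    · exact g1
    · exact g2
  have hd : ∀ a b c, det3 (v a) (v b) (v c) ≠ 0 →
      det3 (h.mulVec (v a)) (h.mulVec (v b)) (h.mulVec (v c)) ≠ 0 := by
    intro a b c habc
    rw [det3_mulVec]
    exact mul_ne_zero hhdet.ne' habc
  refine mem_closure_posConic_of_mulVec hhdet (mem_closure_of_five (j₁ := i) (j₂ := j) (j₃ := k)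
    (p := p) (q := q) ?_ (hS.mulVec h) hij hjk (hi'.trans s0) (hj'.trans s1) (hk'.trans s2)
    (hne p hp.1 hp.2.1 hp.2.2) (hne q hq.1 hq.2.1 hq.2.2)
    (hd _ _ _ (hgen _ _ _ hp.1 hq.1 hpq)) (hd _ _ _ (hgen _ _ _ hp.2.1 hq.2.1 hpq))
    (hd _ _ _ (hgen _ _ _ hp.2.2 hq.2.2 hpq)) fun m => ?_)
  · intro a b c hab hbc
    rw [det3_mulVec]
    exact mul_nonneg hhdet.le (hN a b c hab hbc)
  · by_cases hm : v m = 0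
    · exact Or.inr ⟨0, le_rfl, 0, by simp [hm]⟩
    have key : ∀ e r, v e ≠ 0 → h.mulVec (v e) = Pi.single r 1 → ¬ Indep (v e) (v m) →
        ∃ c : ℝ, 0 ≤ c ∧ ∃ r, h.mulVec (v m) = Pi.single r c := by
      intro e r he her hem
      obtain ⟨c, hc, hcm⟩ := hopp e m he hm hem
      refine ⟨c, hc.le, r, ?_⟩
      rw [hcm, Matrix.mulVec_smul, her, ← Pi.single_smul, smul_eq_mul, mul_one]
    by_cases h1 : Indep (v i) (v m)
    · by_cases h2 : Indep (v j) (v m)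
      · by_cases h3 : Indep (v k) (v m)
        · exact Or.inl (hne m h1 h2 h3)
        · exact Or.inr (key k 2 njk.symm.ne_zero hk' h3)
      · exact Or.inr (key j 1 njk.ne_zero hj' h2)
    · exact Or.inr (key i 0 nij.ne_zero hi' h1)

/-- A nonnegative configuration of rank three, any six vectors of which lie on a conic, is a limit
of positive configurations on nondegenerate conics. -/
theorem mem_closure_posConic (hN : TNonneg v) (hS : SixRel v)
    (hpos : ∃ i j k, i < j ∧ j < k ∧ 0 < det3 (v i) (v j) (v k)) :
    v ∈ closure (posConic n) := by
  by_cases hop : ∃ i j, ∃ μ : ℝ, 0 < μ ∧ v i ≠ 0 ∧ v j = -μ • v i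
  · obtain ⟨i, j, μ, hμ, hi, hij⟩ := hop
    exact mem_closure_of_opposite hN hpos hμ hi hij
  have hopp : ∀ i j, v i ≠ 0 → v j ≠ 0 → ¬ Indep (v i) (v j) → ∃ c : ℝ, 0 < c ∧ v j = c • v i := by
    intro i j hi hj hij
    obtain ⟨c, hc⟩ := exists_smul_of_not_indep hi hij
    refine ⟨c, ?_, hc⟩
    by_contra! hle
    rcases hle.lt_or_eq with h | h
    · exact hop ⟨i, j, -c, by linarith, hi, by rw [neg_neg, hc]⟩
    · exact hj (by rw [hc, h, zero_smul])
  by_cases hco : ∃ a b c, det3 (v a) (v b) (v c) = 0 ∧ Indep (v a) (v b) ∧ Indep (v a) (v c) ∧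
      Indep (v b) (v c)
  · obtain ⟨a, b, c, habc, hab, hac, hbc⟩ := hco
    exact mem_closure_of_coplanar hN hS hpos hopp habc hab hac hbc
  have hgen : ∀ a b c, Indep (v a) (v b) → Indep (v a) (v c) → Indep (v b) (v c) →
      det3 (v a) (v b) (v c) ≠ 0 := fun a b c h1 h2 h3 h => hco ⟨a, b, c, h, h1, h2, h3⟩
  obtain ⟨i, j, k, hij, hjk, hijk⟩ := id hpos
  have nij : Indep (v i) (v j) := ⟨_, hijk.ne'⟩
  have njk : Indep (v j) (v k) := ⟨v i, by rw [det3_rotate]; exact hijk.ne'⟩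
  have nik : Indep (v i) (v k) :=
    ⟨v j, by rw [det3_swap_right]; exact neg_ne_zero.2 hijk.ne'⟩
  have hpar : ∀ e m, v e ≠ 0 → ¬ Indep (v e) (v m) → ∃ c : ℝ, 0 ≤ c ∧ v m = c • v e := by
    intro e m he hem
    by_cases hm : v m = 0
    · exact ⟨0, le_rfl, by simp [hm]⟩
    · obtain ⟨c, hc, h⟩ := hopp e m he hm hem
      exact ⟨c, hc.le, h⟩
  by_cases hp : ∃ p, Indep (v i) (v p) ∧ Indep (v j) (v p) ∧ Indep (v k) (v p)
  · obtain ⟨p, hp1, hp2, hp3⟩ := hp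
    by_cases hq : ∃ q, (Indep (v i) (v q) ∧ Indep (v j) (v q) ∧ Indep (v k) (v q)) ∧
        Indep (v p) (v q)
    · obtain ⟨q, hq, hpq⟩ := hq
      exact mem_closure_of_general hN hS hopp hgen hij hjk hijk ⟨hp1, hp2, hp3⟩ hq hpq
    · have hall : ∀ m, ∃ c : ℝ, 0 ≤ c ∧
          (v m = c • v i ∨ v m = c • v j ∨ v m = c • v k ∨ v m = c • v p) := by
        intro m
        by_cases h1 : Indep (v i) (v m)
        · by_cases h2 : Indep (v j) (v m)
          · by_cases h3 : Indep (v k) (v m)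
            · obtain ⟨c, hc, h⟩ := hpar p m hp1.symm.ne_zero
                fun h4 => hq ⟨m, ⟨h1, h2, h3⟩, h4⟩
              exact ⟨c, hc, by simp [h]⟩
            · obtain ⟨c, hc, h⟩ := hpar k m hp3.ne_zero h3
              exact ⟨c, hc, by simp [h]⟩
          · obtain ⟨c, hc, h⟩ := hpar j m hp2.ne_zero h2
            exact ⟨c, hc, by simp [h]⟩
        · obtain ⟨c, hc, h⟩ := hpar i m hp1.ne_zero h1
          exact ⟨c, hc, by simp [h]⟩
      have hposc : ∀ {a b c}, Cyc a b c → Indep (v a) (v b) → Indep (v a) (v c) →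
          Indep (v b) (v c) → 0 < det3 (v a) (v b) (v c) := fun hc h1 h2 h3 =>
        lt_of_le_of_ne (hN.cyc hc) (hgen _ _ _ h1 h2 h3).symm
      have pi : p ≠ i := by
        rintro rfl; obtain ⟨t, ht⟩ := hp1; simp at ht
      have pj : p ≠ j := by
        rintro rfl; obtain ⟨t, ht⟩ := hp2; simp at ht
      have pk : p ≠ k := by
        rintro rfl; obtain ⟨t, ht⟩ := hp3; simp at ht
      have hc : (Cyc i p j ∧ Cyc i p k ∧ Cyc p j k) ∨ (Cyc i j p ∧ Cyc i p k ∧ Cyc j p k) ∨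
          (Cyc i j p ∧ Cyc i k p ∧ Cyc j k p) := by unfold Cyc; omega
      rcases hc with ⟨c1, c2, c3⟩ | ⟨c1, c2, c3⟩ | ⟨c1, c2, c3⟩
      · refine mem_closure_of_four hN hpos (i := i) (j := p) (k := j) (l := k)
          (hposc c1 hp1 nij hp2.symm) (hposc c2 hp1 nik hp3.symm) hijk
          (hposc c3 hp2.symm hp3.symm njk) fun m => ?_
        obtain ⟨c, hc, h⟩ := hall m
        exact ⟨c, hc, by tauto⟩
      · refine mem_closure_of_four hN hpos (i := i) (j := j) (k := p) (l := k)
          (hposc c1 nij hp1 hp2) hijk (hposc c2 hp1 nik hp3.symm)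
          (hposc c3 hp2 njk hp3.symm) fun m => ?_
        obtain ⟨c, hc, h⟩ := hall m
        exact ⟨c, hc, by tauto⟩
      · exact mem_closure_of_four hN hpos (i := i) (j := j) (k := k) (l := p) hijk
          (hposc c1 nij hp1 hp2) (hposc c2 nik hp1 hp3) (hposc c3 njk hp2 hp3) hall
  · refine mem_closure_of_three hN hpos hijk fun m => ?_
    by_cases h1 : Indep (v i) (v m)
    · by_cases h2 : Indep (v j) (v m)
      · obtain ⟨c, hc, h⟩ := hpar k m njk.symm.ne_zero fun h3 => hp ⟨m, h1, h2, h3⟩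
        exact ⟨c, hc, by simp [h]⟩
      · obtain ⟨c, hc, h⟩ := hpar j m njk.ne_zero h2
        exact ⟨c, hc, by simp [h]⟩
    · obtain ⟨c, hc, h⟩ := hpar i m nij.ne_zero h1
      exact ⟨c, hc, by simp [h]⟩

end

/-! ### Approximation by configurations with a negative minor. -/

/-- Limits of configurations on nondegenerate conics, with a negative minor. -/
def negConic (n : ℕ) : Set (Fin n → Fin 3 → ℝ) :=
  {w | w ∈ closure {w | OnConic w} ∧ ∃ i j k, Cyc i j k ∧ det3 (w i) (w j) (w k) < 0}

section

variable {n : ℕ} {v : Fin n → Fin 3 → ℝ}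

theorem mem_closure_negConic_of_mulVec {g : Matrix (Fin 3) (Fin 3) ℝ} (hg : 0 < g.det)
    (h : (fun i => g.mulVec (v i)) ∈ closure (negConic n)) : v ∈ closure (negConic n) := by
  have hg' : 0 < g⁻¹.det := by
    rw [Matrix.det_nonsing_inv, Ring.inverse_eq_inv']; positivity
  have hc : Continuous fun (v : Fin n → Fin 3 → ℝ) i => g⁻¹.mulVec (v i) :=
    continuous_pi fun i => Continuous.matrix_mulVec continuous_const (continuous_apply i)
  have := map_mem_closure (t := negConic n) hc h fun w hw => by
    obtain ⟨hw, i, j, k, hijk, hneg⟩ := hw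
    refine ⟨map_mem_closure hc hw fun w hw => OnConic.mulVec hw hg'.ne', i, j, k, hijk, ?_⟩
    rw [det3_mulVec]
    exact mul_neg_of_pos_of_neg hg' hneg
  simpa only [Matrix.mulVec_mulVec, Matrix.nonsing_inv_mul _ (isUnit_iff_ne_zero.2 hg.ne'),
    Matrix.one_mulVec] using this

/-- The conic equation is homogeneous in each vector and ignores their order, so it survives
operations that change the signs of minors. -/
theorem OnConic.smul_comp {w : Fin n → Fin 3 → ℝ} (hw : OnConic w) (s : Fin n → ℝ)
    (σ : Fin n → Fin n) : OnConic fun i => s i • w (σ i) := by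
  obtain ⟨h, hh, H⟩ := hw
  refine ⟨h, hh, fun i => ?_⟩
  simp only [Matrix.mulVec_smul, Pi.smul_apply, smul_eq_mul]
  linear_combination s i ^ 2 * H (σ i)

/-- A configuration which is invariant under a rescaled permutation of the vectors that reverses the
sign of a minor. -/
theorem mem_closure_negConic_of_smul_comp (hv : v ∈ closure (posConic n)) (s : Fin n → ℝ)
    (σ : Fin n → Fin n) (hs : ∀ m, s m • v (σ m) = v m) {i j k : Fin n} (hc : Cyc i j k)
    (hneg : ∀ w : Fin n → Fin 3 → ℝ, 0 < det3 (w i) (w j) (w k) →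
      det3 (s i • w (σ i)) (s j • w (σ j)) (s k • w (σ k)) < 0) :
    v ∈ closure (negConic n) := by
  have hcont : Continuous fun (w : Fin n → Fin 3 → ℝ) m => s m • w (σ m) := by fun_prop
  have := map_mem_closure (t := negConic n) hcont hv fun w hw =>
    ⟨subset_closure (OnConic.smul_comp hw.1 s σ), i, j, k, hc, hneg w (by
      rcases hc with ⟨h1, h2⟩ | ⟨h1, h2⟩ | ⟨h1, h2⟩
      · exact hw.2 _ _ _ h1 h2
      · rw [← det3_rotate]; exact hw.2 _ _ _ h1 h2
      · rw [← det3_rotate, ← det3_rotate]; exact hw.2 _ _ _ h1 h2)⟩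
  simpa only [hs] using this

theorem mem_closure_negConic_of_zero (hv : v ∈ closure (posConic n)) {i j k : Fin n}
    (hc : Cyc i j k) (hi : v i = 0) : v ∈ closure (negConic n) := by
  have hij : i ≠ j := by unfold Cyc at hc; omega
  have hik : i ≠ k := by unfold Cyc at hc; omega
  refine mem_closure_negConic_of_smul_comp hv (Function.update 1 i (-1)) id (fun m => ?_) hc
    fun w hw => ?_
  · by_cases h : m = i
    · subst h; simp [hi]
    · simp [h]
  · simp only [Function.update_self, Function.update_of_ne hij.symm, Function.update_of_ne hik.symm,
      det3_smul_left, det3_smul_mid, det3_smul_right, id, Pi.one_apply]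
    linarith

/-- Exchanging the two parallel vectors, rescaled by `c` and `c⁻¹`, fixes `v`. On a nearby positive
configuration the scalars cancel in the minor and the swap reverses its sign. -/
theorem mem_closure_negConic_of_parallel (hv : v ∈ closure (posConic n)) {i j k : Fin n}
    (hc : Cyc i j k) {c : ℝ} (hc0 : c ≠ 0) (hj : v j = c • v i) : v ∈ closure (negConic n) := by
  have hij : i ≠ j := by unfold Cyc at hc; omega
  have hik : k ≠ i := by unfold Cyc at hc; omega
  have hjk : k ≠ j := by unfold Cyc at hc; omega
  refine mem_closure_negConic_of_smul_comp hv
    (Function.update (Function.update 1 i c⁻¹) j c) (Equiv.swap i j) (fun m => ?_) hc fun w hw => ?_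
  · by_cases h : m = j
    · subst h; simp [hj]
    by_cases h' : m = i
    · subst h'
      rw [Equiv.swap_apply_left, Function.update_of_ne h, Function.update_self, hj, smul_smul,
        inv_mul_cancel₀ hc0, one_smul]
    · simp [h, h', Equiv.swap_apply_of_ne_of_ne h' h]
  · simp only [Function.update_self, Function.update_of_ne hij, Function.update_of_ne hik,
      Function.update_of_ne hjk, Equiv.swap_apply_left, Equiv.swap_apply_right,
      Equiv.swap_apply_of_ne_of_ne hik hjk, det3_smul_mid, det3_smul_right,
      Pi.one_apply, det3_swap_left (w i)]
    field_simp
    linarith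

/-- A deformation of a vector in one of the planes `u 0 = 0`, `u 2 = 0` to the conic
`x z = e (t y) ^ 2`. -/
noncomputable def signedSmoothing (e t : ℝ) (u : Fin 3 → ℝ) : Fin 3 → ℝ :=
  open scoped Classical in
  if u 0 ≠ 0 then ![u 0, u 1, e * t ^ 2 * u 1 ^ 2 / u 0]
  else if u 2 ≠ 0 then ![e * t ^ 2 * u 1 ^ 2 / u 2, u 1, u 2]
  else ![t * u 1, u 1, e * t * u 1]

theorem tendsto_signedSmoothing (e : ℝ) {u : Fin 3 → ℝ} (h : u 0 * u 2 = 0) :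
    Tendsto (fun t => signedSmoothing e t u) (𝓝[>] 0) (𝓝 u) := by
  have hc : Continuous fun t => signedSmoothing e t u := by
    unfold signedSmoothing
    split_ifs
    all_goals
      refine continuous_pi fun i => ?_
      fin_cases i <;> simp <;> fun_prop
  have hz : signedSmoothing e 0 u = u := by
    unfold signedSmoothing
    split_ifs with h1 h3
    · have h2 : u 2 = 0 := by simpa [h1] using h
      ext i; fin_cases i <;> simp [h2]
    · have h2 : u 0 = 0 := by simpa [h3] using h
      ext i; fin_cases i <;> simp [h2]
    · push Not at h1 h3
      ext i; fin_cases i <;> simp [h1, h3]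
  have := (hc.continuousWithinAt (s := Set.Ioi 0) (x := 0)).tendsto
  rwa [hz] at this

theorem onConic_signedSmoothing {e t : ℝ} (he : e ^ 2 = 1) (ht : t ≠ 0)
    (u : Fin n → Fin 3 → ℝ) : OnConic fun i => signedSmoothing e t (u i) := by
  have he0 : e ≠ 0 := by rintro rfl; simp at he
  refine ⟨Matrix.diagonal ![e, t, 1], ?_, fun i => ?_⟩
  · simp [Matrix.det_diagonal, Fin.prod_univ_three, he0, ht]
  · simp only [Matrix.mulVec_diagonal]
    unfold signedSmoothing
    split_ifs with h1 h2 <;> simp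
    · field_simp
      rw [he, one_mul]
    · field_simp
      rw [he, one_mul]
    · linear_combination (t ^ 2 * u i 1 ^ 2) * he

/-- Configurations on two planes are limits of configurations on nondegenerate conics. -/
theorem mem_closure_onConic_of_planes {u : Fin n → Fin 3 → ℝ} (h : ∀ i, u i 0 * u i 2 = 0) :
    u ∈ closure {w | OnConic w} :=
  mem_closure_of_tendsto (tendsto_pi_nhds.2 fun i => tendsto_signedSmoothing 1 (h i))
    (by
      filter_upwards [self_mem_nhdsWithin] with t ht
      exact onConic_signedSmoothing (one_pow 2) (ne_of_gt ht) u)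

theorem area_ne_zero {u v : Fin 3 → ℝ} (h : Indep u v) (hu : u 2 = 0) (hv : v 2 = 0) :
    u 0 * v 1 - v 0 * u 1 ≠ 0 := by
  intro h0
  obtain ⟨t, ht⟩ := h
  apply ht
  simp only [det3, hu, hv]
  linear_combination t 2 * h0

/-- The hypotheses put `u i` on the common line of the planes. It can leave `z = 0` inside the plane
`x = 0` in either direction; the shift `-t * A` makes the minor `-t * A ^ 2`. -/
theorem mem_closure_negConic_of_node {u : Fin n → Fin 3 → ℝ} (h : ∀ i, u i 0 * u i 2 = 0)
    {i j k : Fin n} (hc : Cyc i j k) (hj2 : u j 2 = 0) (hk2 : u k 2 = 0)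
    (hjk : Indep (u j) (u k)) (hi : u i 0 = 0) (h0 : det3 (u i) (u j) (u k) = 0) :
    u ∈ closure (negConic n) := by
  have hij : j ≠ i := by unfold Cyc at hc; omega
  have hik : k ≠ i := by unfold Cyc at hc; omega
  set A := u j 0 * u k 1 - u k 0 * u j 1 with hA
  have hA0 : A ≠ 0 := area_ne_zero hjk hj2 hk2
  set F : ℝ → Fin n → Fin 3 → ℝ := fun t =>
    Function.update u i ![u i 0, u i 1, u i 2 - t * A] with hF
  have hcont : Continuous F := by
    refine continuous_const.update i (continuous_pi fun r => ?_)
    fin_cases r <;> simp <;> fun_prop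
  have hF0 : F 0 = u := by
    have : ![u i 0, u i 1, u i 2] = u i := by ext r; fin_cases r <;> rfl
    simp [hF, this]
  rw [← hF0]
  refine mem_closure_of_tendsto (hcont.continuousWithinAt (s := Set.Ioi 0)).tendsto ?_
  filter_upwards [self_mem_nhdsWithin] with t ht
  have ht' : 0 < t := ht
  refine ⟨mem_closure_onConic_of_planes fun m => ?_, i, j, k, hc, ?_⟩
  · by_cases hm : m = i
    · subst hm; simp [hF, hi]
    · simp [hF, hm, h m]
  · simp only [hF, Function.update_self, Function.update_of_ne hij, Function.update_of_ne hik]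
    have e : det3 ![u i 0, u i 1, u i 2 - t * A] (u j) (u k) =
        det3 (u i) (u j) (u k) - t * A ^ 2 := by
      simp [det3, hj2, hk2, hA]; ring
    rw [e, h0]
    have : 0 < t * A ^ 2 := by positivity
    linarith

/-- Away from the common line, the two smoothings `x z = ± (t y) ^ 2` bend the plane `z = 0` in
opposite ways, giving the minor `t ^ 2 * (e * D)`. The sign `e` is chosen against `D`. -/
theorem mem_closure_negConic_of_planes {u : Fin n → Fin 3 → ℝ} (h : ∀ i, u i 0 * u i 2 = 0)
    {i j k : Fin n} (hc : Cyc i j k) (hi2 : u i 2 = 0) (hj2 : u j 2 = 0) (hk2 : u k 2 = 0)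
    (hij : Indep (u i) (u j)) (hik : Indep (u i) (u k)) (hjk : Indep (u j) (u k)) :
    u ∈ closure (negConic n) := by
  have h0 : det3 (u i) (u j) (u k) = 0 := by simp [det3, hi2, hj2, hk2]
  by_cases hi : u i 0 = 0
  · exact mem_closure_negConic_of_node h hc hj2 hk2 hjk hi h0
  by_cases hj : u j 0 = 0
  · exact mem_closure_negConic_of_node h hc.rotate hk2 hi2 hik.symm hj (by rwa [det3_rotate])
  by_cases hk : u k 0 = 0
  · exact mem_closure_negConic_of_node h hc.rotate.rotate hi2 hj2 hij hk
      (by rwa [det3_rotate, det3_rotate])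
  set D := (u i 0 * u j 1 - u j 0 * u i 1) * (u i 0 * u k 1 - u k 0 * u i 1) *
    (u j 0 * u k 1 - u k 0 * u j 1) / (u i 0 * u j 0 * u k 0) with hD
  have hD0 : D ≠ 0 := div_ne_zero (mul_ne_zero (mul_ne_zero (area_ne_zero hij hi2 hj2)
    (area_ne_zero hik hi2 hk2)) (area_ne_zero hjk hj2 hk2)) (by simp [hi, hj, hk])
  obtain ⟨e, he, heD⟩ : ∃ e : ℝ, e ^ 2 = 1 ∧ e * D < 0 := by
    rcases lt_or_gt_of_ne hD0 with h | h
    · exact ⟨1, by norm_num, by linarith⟩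
    · exact ⟨-1, by norm_num, by linarith⟩
  refine mem_closure_of_tendsto (tendsto_pi_nhds.2 fun i => tendsto_signedSmoothing e (h i)) ?_
  filter_upwards [self_mem_nhdsWithin] with t ht
  have ht' : 0 < t := ht
  refine ⟨subset_closure (onConic_signedSmoothing he ht'.ne' u), i, j, k, hc, ?_⟩
  have e1 : det3 (signedSmoothing e t (u i)) (signedSmoothing e t (u j))
      (signedSmoothing e t (u k)) = t ^ 2 * (e * D) := by
    simp only [signedSmoothing, hi, hj, hk, ne_eq, not_false_eq_true, if_true, hD]
    simp [det3]
    field_simp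
    ring
  rw [e1]
  exact mul_neg_of_pos_of_neg (by positivity) heD

/-- A nonnegative configuration of rank three on a conic with a vanishing minor is a limit of
configurations on conics with a negative minor. -/
theorem mem_closure_negConic (hN : TNonneg v) (hS : SixRel v)
    (hpos : ∃ i j k, i < j ∧ j < k ∧ 0 < det3 (v i) (v j) (v k)) {i j k : Fin n}
    (hc : Cyc i j k) (h0 : det3 (v i) (v j) (v k) = 0) : v ∈ closure (negConic n) := by
  have hv := mem_closure_posConic hN hS hpos
  have hpar : ∀ {i j k}, Cyc i j k → ¬ Indep (v i) (v j) → v ∈ closure (negConic n) := by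
    intro i j k hc hij
    by_cases hi : v i = 0
    · exact mem_closure_negConic_of_zero hv hc hi
    obtain ⟨c, hcj⟩ := exists_smul_of_not_indep hi hij
    by_cases hc0 : c = 0
    · exact mem_closure_negConic_of_zero hv hc.rotate (by rw [hcj, hc0, zero_smul])
    · exact mem_closure_negConic_of_parallel hv hc hc0 hcj
  by_cases hij : Indep (v i) (v j)
  swap
  · exact hpar hc hij
  by_cases hjk : Indep (v j) (v k)
  swap
  · exact hpar hc.rotate hjk
  by_cases hik : Indep (v i) (v k)
  swap
  · exact hpar hc.rotate.rotate fun h => hik h.symm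
  obtain ⟨i₀, j₀, k₀, -, -, hd⟩ := hpos
  obtain ⟨l, -, hl⟩ := exists_det3_ne_zero hd.ne' hij
  obtain ⟨a, b, hab, hz⟩ : ∃ a b, Indep a b ∧
      ∀ m, det3 (v i) (v j) (v m) ≠ 0 → det3 a b (v m) = 0 := by
    by_cases hoff : ∃ l₁ l₂, det3 (v i) (v j) (v l₁) ≠ 0 ∧ det3 (v i) (v j) (v l₂) ≠ 0 ∧
        Indep (v l₁) (v l₂)
    · obtain ⟨l₁, l₂, h1, h2, h12⟩ := hoff
      exact ⟨v l₁, v l₂, h12, fun m hm => hS.det3_eq_zero h0 hik hjk h1 h2 hm⟩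
    · push Not at hoff
      refine ⟨v i, v l, ⟨v j, by rw [det3_swap_right]; exact neg_ne_zero.2 hl⟩, fun m hm => ?_⟩
      have hln : v l ≠ 0 := by intro h; simp [h, det3] at hl
      obtain ⟨r, hr⟩ := exists_smul_of_not_indep hln (hoff l m hl hm)
      rw [hr, det3_smul_right, det3_self_right, mul_zero]
  obtain ⟨h, hh, H⟩ := exists_wedge_coords ⟨i₀, j₀, k₀, hd.ne'⟩ hij hab fun m => by
    by_cases hm : det3 (v i) (v j) (v m) = 0
    · rw [hm, zero_mul]
    · rw [hz m hm, mul_zero]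
  have hind : ∀ {x y : Fin 3 → ℝ}, Indep x y → Indep (h.mulVec x) (h.mulVec y) := by
    rintro x y ⟨t, ht⟩
    exact ⟨h.mulVec t, by rw [det3_mulVec]; exact mul_ne_zero hh.ne' ht⟩
  refine mem_closure_negConic_of_mulVec hh (mem_closure_negConic_of_planes (i := i) (j := j)
    (k := k) (fun m => ?_) hc ?_ ?_ ?_ (hind hij) (hind hik) (hind hjk))
  · rw [(H _).1, (H _).2]
    by_cases hm : det3 (v i) (v j) (v m) = 0
    · rw [hm, mul_zero]
    · rw [hz m hm, zero_mul]
  · rw [(H _).2]; simp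
  · rw [(H _).2]; simp
  · rw [(H _).2]; exact h0

end

/-! ### The Grassmannian, its topology, and the ABCT variety. -/

section

variable {n : ℕ}

theorem Gr.mk_eq_iff {K : Type*} [Field K] {k n : ℕ} {M N : FullRank K k n} :
    Gr.mk M = Gr.mk N ↔ ∃ g : GL (Fin k) K, N.1 = (g : Matrix (Fin k) (Fin k) K) * M.1 :=
  Quotient.eq (r := rowSetoid K k n)

theorem Gr.exists_rep {K : Type*} [Field K] {k n : ℕ} (x : Gr K k n) :
    ∃ M : FullRank K k n, Gr.mk M = x :=
  Quotient.exists_rep x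

theorem submatrix_mul_left {K : Type*} [CommRing K] {k n : ℕ} (g : Matrix (Fin k) (Fin k) K)
    (M : Matrix (Fin k) (Fin n) K) (f : Fin k → Fin n) :
    ((g * M).submatrix id f).det = g.det * (M.submatrix id f).det := by
  rw [← Matrix.det_mul]; rfl

theorem minor_mul {K : Type*} [CommRing K] {k n : ℕ} (g : Matrix (Fin k) (Fin k) K)
    (M : Matrix (Fin k) (Fin n) K) (I : Fin k ↪o Fin n) :
    minor (g * M) I = g.det * minor M I :=
  submatrix_mul_left g M I

/-- The columns of a matrix. -/
def cols (M : FullRank ℝ 3 n) : Fin n → Fin 3 → ℝ := fun i r => M.1 r i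

theorem minor_eq_det3 (M : FullRank ℝ 3 n) (I : Fin 3 ↪o Fin n) :
    minor M.1 I = det3 (cols M (I 0)) (cols M (I 1)) (cols M (I 2)) := by
  simp [minor, Matrix.det_fin_three, det3, cols]; ring

/-- An increasing triple as an order embedding. -/
def triple {i j k : Fin n} (hij : i < j) (hjk : j < k) : Fin 3 ↪o Fin n :=
  OrderEmbedding.ofStrictMono ![i, j, k] (by
    intro a b hab
    fin_cases a <;> fin_cases b <;> simp at hab ⊢
    · exact hij
    · exact hij.trans hjk
    · exact hjk)

theorem minor_triple (M : FullRank ℝ 3 n) {i j k : Fin n} (hij : i < j) (hjk : j < k) :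
    minor M.1 (triple hij hjk) = det3 (cols M i) (cols M j) (cols M k) :=
  minor_eq_det3 M _

theorem forall_minor_iff (M : FullRank ℝ 3 n) (P : ℝ → Prop) :
    (∀ I, P (minor M.1 I)) ↔
      ∀ i j k, i < j → j < k → P (det3 (cols M i) (cols M j) (cols M k)) := by
  constructor
  · intro h i j k hij hjk
    rw [← minor_triple M hij hjk]; exact h _
  · intro h I
    rw [minor_eq_det3]
    exact h _ _ _ (by simp) (by simp)

theorem isOpen_fullRank (k n : ℕ) :
    IsOpen {M : Matrix (Fin k) (Fin n) ℝ | ∃ I : Fin k ↪o Fin n, minor M I ≠ 0} := by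
  simp only [Set.ofPred_exists]
  refine isOpen_iUnion fun I => isOpen_ne_fun ?_ continuous_const
  unfold minor
  fun_prop

theorem continuous_minor {k n : ℕ} (I : Fin k ↪o Fin n) :
    Continuous fun M : FullRank ℝ k n => minor M.1 I := by
  have : Continuous fun M : Matrix (Fin k) (Fin n) ℝ => minor M I := by
    unfold minor; fun_prop
  exact this.comp continuous_subtype_val

theorem continuous_cols : Continuous (cols : FullRank ℝ 3 n → _) := by
  have : Continuous fun (M : Matrix (Fin 3) (Fin n) ℝ) i r => M r i := by fun_prop
  exact this.comp continuous_subtype_val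

theorem isOpenMap_cols : IsOpenMap (cols : FullRank ℝ 3 n → _) := by
  have h1 : IsOpenMap (Subtype.val : FullRank ℝ 3 n → Matrix (Fin 3) (Fin n) ℝ) :=
    (isOpen_fullRank 3 n).isOpenMap_subtype_val
  let e : Matrix (Fin 3) (Fin n) ℝ ≃ₜ (Fin n → Fin 3 → ℝ) :=
    { toFun := fun M i r => M r i
      invFun := fun v r i => v i r
      left_inv := fun _ => rfl
      right_inv := fun _ => rfl
      continuous_toFun := by fun_prop
      continuous_invFun := by fun_prop }
  exact e.isOpenMap.comp h1

theorem continuous_mk (k n : ℕ) : Continuous (Gr.mk : FullRank ℝ k n → Gr ℝ k n) :=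
  continuous_coinduced_rng

theorem isClosed_iff {k n : ℕ} {S : Set (Gr ℝ k n)} : IsClosed S ↔ IsClosed (Gr.mk ⁻¹' S) :=
  isClosed_coinduced

theorem isOpen_iff {k n : ℕ} {S : Set (Gr ℝ k n)} : IsOpen S ↔ IsOpen (Gr.mk ⁻¹' S) :=
  isOpen_coinduced

/-- Limits of configurations of vectors give limits in the Grassmannian. -/
theorem mk_mem_closure {S : Set (Fin n → Fin 3 → ℝ)} {T : Set (Gr ℝ 3 n)} {M : FullRank ℝ 3 n}
    (hM : cols M ∈ closure S) (hST : ∀ N : FullRank ℝ 3 n, cols N ∈ S → Gr.mk N ∈ T) :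
    Gr.mk M ∈ closure T := by
  have h : M ∈ closure (cols ⁻¹' S) := by
    rw [← isOpenMap_cols.preimage_closure_eq_closure_preimage continuous_cols]
    exact hM
  exact map_mem_closure (continuous_mk 3 n) h hST

theorem exists_minor_ne_zero (M : FullRank ℝ 3 n) :
    ∃ i j k, i < j ∧ j < k ∧ det3 (cols M i) (cols M j) (cols M k) ≠ 0 := by
  obtain ⟨I, hI⟩ := M.2
  rw [minor_eq_det3] at hI
  exact ⟨_, _, _, by simp, by simp, hI⟩

theorem minor_mul_nonneg_of_mem_GrNonneg {M : FullRank ℝ 3 n} (h : Gr.mk M ∈ GrNonneg 3 n)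
    (I J : Fin 3 ↪o Fin n) : 0 ≤ minor M.1 I * minor M.1 J := by
  obtain ⟨N, hN, hpos⟩ := h
  obtain ⟨g, hg⟩ := Gr.mk_eq_iff.1 hN
  rw [hg, minor_mul, minor_mul]
  have := mul_nonneg (hpos I) (hpos J)
  have := mul_nonneg (sq_nonneg (g : Matrix (Fin 3) (Fin 3) ℝ).det) this
  linarith

theorem minor_mul_pos_of_mem_GrPos {M : FullRank ℝ 3 n} (h : Gr.mk M ∈ GrPos 3 n)
    (I J : Fin 3 ↪o Fin n) : 0 < minor M.1 I * minor M.1 J := by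
  obtain ⟨N, hN, hpos⟩ := h
  obtain ⟨g, hg⟩ := Gr.mk_eq_iff.1 hN
  rw [hg, minor_mul, minor_mul]
  have hg0 : (g : Matrix (Fin 3) (Fin 3) ℝ).det ≠ 0 :=
    ((Matrix.isUnit_iff_isUnit_det _).1 g.isUnit).ne_zero
  have := mul_pos (hpos I) (hpos J)
  have := mul_pos (sq_pos_of_ne_zero hg0) this
  linarith

/-- Each point has a representative with the opposite minors. -/
theorem exists_neg_rep (M : FullRank ℝ 3 n) :
    ∃ N : FullRank ℝ 3 n, Gr.mk N = Gr.mk M ∧ ∀ I, minor N.1 I = -minor M.1 I := by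
  have hd : ((-1 : GL (Fin 3) ℝ) : Matrix (Fin 3) (Fin 3) ℝ).det = -1 := by
    simp [Matrix.det_neg]; norm_num
  have hm : ∀ I, minor (((-1 : GL (Fin 3) ℝ) : Matrix (Fin 3) (Fin 3) ℝ) * M.1) I =
      -minor M.1 I := fun I => by rw [minor_mul, hd, neg_one_mul]
  refine ⟨⟨((-1 : GL (Fin 3) ℝ) : Matrix (Fin 3) (Fin 3) ℝ) * M.1, ?_⟩, ?_, hm⟩
  · obtain ⟨I, hI⟩ := M.2
    exact ⟨I, by rw [hm]; exact neg_ne_zero.2 hI⟩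
  · exact (Gr.mk_eq_iff.2 ⟨(-1 : GL (Fin 3) ℝ), rfl⟩).symm

/-- A change of representative multiplies all minors by one nonzero real, so products of two minors
have a well-defined sign. This removes the choice of representative and shows that the condition is
closed. -/
theorem mk_mem_GrNonneg_iff {M : FullRank ℝ 3 n} :
    Gr.mk M ∈ GrNonneg 3 n ↔ ∀ I J, 0 ≤ minor M.1 I * minor M.1 J := by
  refine ⟨minor_mul_nonneg_of_mem_GrNonneg, fun h => ?_⟩
  obtain ⟨J, hJ⟩ := M.2
  rcases lt_or_gt_of_ne hJ with hJ | hJ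
  · obtain ⟨N, hN, hm⟩ := exists_neg_rep M
    exact ⟨N, hN, fun I => by rw [hm]; nlinarith [h I J]⟩
  · exact ⟨M, rfl, fun I => nonneg_of_mul_nonneg_left (h I J) hJ⟩

theorem mk_mem_GrPos_iff {M : FullRank ℝ 3 n} :
    Gr.mk M ∈ GrPos 3 n ↔ ∀ I J, 0 < minor M.1 I * minor M.1 J := by
  refine ⟨minor_mul_pos_of_mem_GrPos, fun h => ?_⟩
  obtain ⟨J, hJ⟩ := M.2
  rcases lt_or_gt_of_ne hJ with hJ | hJ
  · obtain ⟨N, hN, hm⟩ := exists_neg_rep M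
    exact ⟨N, hN, fun I => by rw [hm]; nlinarith [h I J]⟩
  · exact ⟨M, rfl, fun I => pos_of_mul_pos_left (h I J) hJ.le⟩

theorem isClosed_GrNonneg : IsClosed (GrNonneg 3 n) := by
  rw [isClosed_iff]
  have : Gr.mk ⁻¹' GrNonneg 3 n = ⋂ I, ⋂ J, {M | 0 ≤ minor M.1 I * minor M.1 J} := by
    ext M; simp [mk_mem_GrNonneg_iff]
  rw [this]
  exact isClosed_iInter fun I => isClosed_iInter fun J =>
    isClosed_le continuous_const ((continuous_minor I).mul (continuous_minor J))

theorem isOpen_GrPos : IsOpen (GrPos 3 n) := by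
  rw [isOpen_iff]
  have : Gr.mk ⁻¹' GrPos 3 n = ⋂ I, ⋂ J, {M | 0 < minor M.1 I * minor M.1 J} := by
    ext M; simp [mk_mem_GrPos_iff]
  rw [this]
  exact isOpen_iInter_of_finite fun I => isOpen_iInter_of_finite fun J =>
    isOpen_lt continuous_const ((continuous_minor I).mul (continuous_minor J))

theorem GrPos_subset_GrNonneg : GrPos 3 n ⊆ GrNonneg 3 n := by
  rintro x ⟨M, hM, h⟩
  exact ⟨M, hM, fun I => (h I).le⟩

theorem toComplex_mk (M : FullRank ℝ 3 n) : (Gr.mk M).toComplex = Gr.mk M.toComplex := rfl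

theorem isClosed_VReal : IsClosed (VReal 3 n) := by
  rw [isClosed_iff]
  have key : ∀ F : MvPolynomial (Fin 3 ↪o Fin n) ℂ,
      IsClosed {M : FullRank ℝ 3 n | VanishesAt F (Gr.mk M.toComplex)} := by
    intro F
    -- Vanishing is required at every complex representative, hence one closed polynomial condition
    -- on the real minors for each `g`.
    have : {M : FullRank ℝ 3 n | VanishesAt F (Gr.mk M.toComplex)} =
        ⋂ g : GL (Fin 3) ℂ, {M | MvPolynomial.eval (fun I =>
          (g : Matrix (Fin 3) (Fin 3) ℂ).det * Complex.ofRealHom (minor M.1 I)) F = 0} := by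
      ext M
      simp only [Set.mem_ofPred_eq, Set.mem_iInter]
      have hm : ∀ (g : GL (Fin 3) ℂ) I, minor ((g : Matrix (Fin 3) (Fin 3) ℂ) * M.toComplex.1) I =
          (g : Matrix (Fin 3) (Fin 3) ℂ).det * Complex.ofRealHom (minor M.1 I) := by
        intro g I
        rw [minor_mul]
        congr 1
        exact minor_map _ _ _
      constructor
      · intro h g
        have hg0 : (g : Matrix (Fin 3) (Fin 3) ℂ).det ≠ 0 :=
          ((Matrix.isUnit_iff_isUnit_det _).1 g.isUnit).ne_zero
        obtain ⟨I, hI⟩ := M.2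
        have hN : ∃ I : Fin 3 ↪o Fin n,
            minor ((g : Matrix (Fin 3) (Fin 3) ℂ) * M.toComplex.1) I ≠ 0 :=
          ⟨I, by rw [hm]; exact mul_ne_zero hg0 (by simpa using hI)⟩
        have := h ⟨_, hN⟩ (Gr.mk_eq_iff.2 ⟨g, rfl⟩).symm
        rw [← this]
        congr 2
        funext I
        exact (hm g I).symm
      · intro h N hN
        obtain ⟨g, hg⟩ := Gr.mk_eq_iff.1 hN.symm
        refine Eq.trans ?_ (h g)
        congr 2
        funext I
        exact (congrArg (minor · I) hg).trans (hm g I)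
    rw [this]
    refine isClosed_iInter fun g => isClosed_eq ?_ continuous_const
    refine (MvPolynomial.continuous_eval F).comp (continuous_pi fun I => ?_)
    exact continuous_const.mul (Complex.continuous_ofReal.comp (continuous_minor I))
  have : Gr.mk ⁻¹' VReal 3 n = ⋂ (d : ℕ) (F : MvPolynomial (Fin 3 ↪o Fin n) ℂ)
      (_ : F.IsHomogeneous d) (_ : ∀ y ∈ veroneseImage ℂ 3 n, VanishesAt F y),
      {M : FullRank ℝ 3 n | VanishesAt F (Gr.mk M.toComplex)} := by
    ext M
    simp only [Set.mem_iInter]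
    rfl
  rw [this]
  exact isClosed_iInter fun d => isClosed_iInter fun F => isClosed_iInter fun _ =>
    isClosed_iInter fun _ => key F

theorem det_veronese {K : Type*} [Field K] (A : Matrix (Fin 2) (Fin n) K) (f : Fin 3 → Fin n) :
    ((veronese 3 A).submatrix id f).det =
      (A 0 (f 0) * A 1 (f 1) - A 0 (f 1) * A 1 (f 0)) *
      (A 0 (f 0) * A 1 (f 2) - A 0 (f 2) * A 1 (f 0)) *
      (A 0 (f 1) * A 1 (f 2) - A 0 (f 2) * A 1 (f 1)) := by
  simp [Matrix.det_fin_three, veronese]; ring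

theorem subset_zariskiClosure {K : Type*} [Field K] {k n : ℕ} (S : Set (Gr K k n)) :
    S ⊆ zariskiClosure S := fun x hx _ _ _ h => h x hx

/-- Real configurations on a nondegenerate conic are in the ABCT variety. -/
theorem OnConic.mk_mem_VReal {M : FullRank ℝ 3 n} (hM : OnConic (cols M)) :
    Gr.mk M ∈ VReal 3 n := by
  obtain ⟨h, hh, H⟩ := hM
  set hC := h.map Complex.ofRealHom with hhC
  have hdet : hC.det = (h.det : ℂ) := (RingHom.map_det Complex.ofRealHom h).symm
  have hdet0 : hC.det ≠ 0 := by rw [hdet]; exact_mod_cast hh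
  set w : Fin n → Fin 3 → ℂ := fun i r => (hC * M.toComplex.1) r i with hw
  have hwr : ∀ i r, w i r = (h.mulVec (cols M i) r : ℂ) := by
    intro i r
    simp [hw, hhC, Matrix.mul_apply, Matrix.mulVec, dotProduct, FullRank.toComplex, cols]
  have hwc : ∀ i, w i 0 * w i 2 = w i 1 ^ 2 := by
    intro i
    simp only [hwr]
    exact_mod_cast H i
  -- A real vector of the cone may be the negative of a real Veronese vector; over ℂ the square
  -- roots always exist.
  have hex : ∀ i, ∃ a b : ℂ, w i 0 = a ^ 2 ∧ w i 1 = a * b ∧ w i 2 = b ^ 2 := by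
    intro i
    obtain ⟨a, ha⟩ := IsAlgClosed.exists_pow_nat_eq (w i 0) (n := 2) (by norm_num)
    by_cases h0 : a = 0
    · obtain ⟨b, hb⟩ := IsAlgClosed.exists_pow_nat_eq (w i 2) (n := 2) (by norm_num)
      have h1 := hwc i
      rw [← ha, h0] at h1
      refine ⟨a, b, ha.symm, ?_, hb.symm⟩
      have : w i 1 = 0 := by simpa using h1.symm
      rw [this, h0, zero_mul]
    · refine ⟨a, w i 1 / a, ha.symm, by field_simp, ?_⟩
      rw [div_pow, ← hwc i, ha, mul_comm, mul_div_assoc, div_self, mul_one]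
      rw [← ha]; exact pow_ne_zero 2 h0
  choose a b h0 h1 h2 using hex
  set A : Matrix (Fin 2) (Fin n) ℂ := Matrix.of ![a, b] with hA
  have hver : veronese 3 A = hC * M.toComplex.1 := by
    ext r i
    have : (hC * M.toComplex.1) r i = w i r := rfl
    rw [this]
    fin_cases r
    · simp [veronese, hA, h0]
    · simp [veronese, hA, h1]
    · simp [veronese, hA, h2]
  obtain ⟨J, hJ⟩ := M.toComplex.2
  have hJ' : minor (veronese 3 A) J ≠ 0 := by
    rw [hver, minor_mul]; exact mul_ne_zero hdet0 hJ
  have hArank : ∃ I : Fin 2 ↪o Fin n, minor A I ≠ 0 := by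
    refine ⟨(Fin.castSuccOrderEmb (n := 2)).trans J, fun hI => hJ' ?_⟩
    have e : A 0 (J 0) * A 1 (J 1) - A 0 (J 1) * A 1 (J 0) = 0 := by
      rw [← hI]
      simp [minor, Matrix.det_fin_two]
    unfold minor
    rw [det_veronese, e]; ring
  refine subset_zariskiClosure _ ⟨⟨A, hArank⟩, ⟨veronese 3 A, J, hJ'⟩, rfl, ?_⟩
  rw [toComplex_mk]
  exact (Gr.mk_eq_iff.2 ⟨Matrix.GeneralLinearGroup.mkOfDetNeZero hC hdet0, hver⟩).symm

theorem mk_mem_VReal_of_mem_closure {M : FullRank ℝ 3 n}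
    (hM : cols M ∈ closure {w | OnConic w}) : Gr.mk M ∈ VReal 3 n := by
  rw [← isClosed_VReal.closure_eq]
  exact mk_mem_closure hM fun N hN => OnConic.mk_mem_VReal hN

/-- Minors on arbitrary columns are linear forms in the Plücker coordinates. -/
theorem exists_linear_form {K : Type*} [Field K] {k n : ℕ} (f : Fin k → Fin n) :
    ∃ q : MvPolynomial (Fin k ↪o Fin n) K, q.IsHomogeneous 1 ∧
      ∀ M : Matrix (Fin k) (Fin n) K,
        MvPolynomial.eval (minor M) q = (M.submatrix id f).det := by
  by_cases hf : Function.Injective f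
  · set σ := Tuple.sort f with hσ
    have hmono : StrictMono (f ∘ σ) :=
      (Tuple.monotone_sort f).strictMono_of_injective (hf.comp σ.injective)
    refine ⟨MvPolynomial.C ((Equiv.Perm.sign σ : ℤ) : K) *
      MvPolynomial.X (OrderEmbedding.ofStrictMono _ hmono),
      MvPolynomial.isHomogeneous_C_mul_X _ _, fun M => ?_⟩
    have h1 : minor M (OrderEmbedding.ofStrictMono _ hmono) =
        ((M.submatrix id f).submatrix id σ).det := rfl
    rw [map_mul, MvPolynomial.eval_C, MvPolynomial.eval_X, h1, Matrix.det_permute', ← mul_assoc]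
    have h2 : ((Equiv.Perm.sign σ : ℤ) : K) * ((Equiv.Perm.sign σ : ℤ) : K) = 1 := by
      rw [← Int.cast_mul, ← Units.val_mul, Int.units_mul_self]; simp
    rw [h2, one_mul]
  · refine ⟨0, MvPolynomial.isHomogeneous_zero _ _ _, fun M => ?_⟩
    rw [map_zero]
    simp only [Function.Injective, not_forall] at hf
    obtain ⟨i, j, hij, hne⟩ := hf
    refine (Matrix.det_zero_of_column_eq hne fun r => ?_).symm
    simp [hij]

/-- On the real points of the ABCT variety, any six columns lie on a conic. -/
theorem sixRel_of_mem_VReal {M : FullRank ℝ 3 n} (hM : Gr.mk M ∈ VReal 3 n) :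
    SixRel (cols M) := by
  intro a b c d e f
  choose q hq hqe using fun g : Fin 3 → Fin n => exists_linear_form (K := ℂ) g
  set F := q ![a, b, c] * q ![a, d, e] * q ![b, d, f] * q ![c, e, f] -
    q ![a, b, d] * q ![a, c, e] * q ![b, c, f] * q ![d, e, f] with hF
  have hhom : F.IsHomogeneous (1 + 1 + 1 + 1) :=
    ((((hq _).mul (hq _)).mul (hq _)).mul (hq _)).sub ((((hq _).mul (hq _)).mul (hq _)).mul (hq _))
  have hvan : ∀ y ∈ veroneseImage ℂ 3 n, VanishesAt F y := by
    rintro y ⟨A, N, hN, rfl⟩ N' hN'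
    obtain ⟨g, hg⟩ := Gr.mk_eq_iff.1 hN'.symm
    rw [hF, hg, hN]
    simp only [map_sub, map_mul, hqe, submatrix_mul_left, det_veronese]
    simp only [Matrix.cons_val_zero, Matrix.cons_val_one, Matrix.cons_val]
    -- Both sides expand into the same twelve 2 × 2 minors.
    generalize hp : (fun i j => A.1 0 i * A.1 1 j - A.1 0 j * A.1 1 i) = p
    have hp' : ∀ i j, A.1 0 i * A.1 1 j - A.1 0 j * A.1 1 i = p i j := fun i j => by rw [← hp]
    simp only [hp']
    ring
  have := hM _ F hhom hvan M.toComplex rfl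
  have hdet : ∀ i j k, (M.toComplex.1.submatrix id ![i, j, k]).det =
      ((det3 (cols M i) (cols M j) (cols M k) : ℝ) : ℂ) := by
    intro i j k
    simp [Matrix.det_fin_three, FullRank.toComplex, det3, cols]; ring
  rw [hF] at this
  simp only [map_sub, map_mul, hqe, hdet] at this
  rw [sub_eq_zero] at this
  exact_mod_cast this

/-- Nonnegative points of the ABCT variety are limits of positive ones. -/
theorem VNonneg_subset_closure : VNonneg 3 n ⊆ closure (VReal 3 n ∩ GrPos 3 n) := by
  rintro x ⟨hV, M, rfl, hM⟩
  have hN : TNonneg (cols M) := (forall_minor_iff M (fun x => 0 ≤ x)).1 hM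
  obtain ⟨i, j, k, hij, hjk, h⟩ := exists_minor_ne_zero M
  refine mk_mem_closure (mem_closure_posConic hN (sixRel_of_mem_VReal hV)
    ⟨i, j, k, hij, hjk, lt_of_le_of_ne (hN i j k hij hjk) h.symm⟩) fun N hN => ?_
  exact ⟨hN.1.mk_mem_VReal, N, rfl, (forall_minor_iff N (fun x => 0 < x)).2 hN.2⟩

/-- Nonnegative points of the ABCT variety that are not positive are limits of points of the variety
that are not nonnegative. -/
theorem mem_closure_diff {x : Gr ℝ 3 n} (hx : x ∈ VNonneg 3 n) (hx' : x ∉ GrPos 3 n) :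
    x ∈ closure (VReal 3 n \ GrNonneg 3 n) := by
  obtain ⟨hV, M, rfl, hM⟩ := hx
  have hN : TNonneg (cols M) := (forall_minor_iff M (fun x => 0 ≤ x)).1 hM
  obtain ⟨i, j, k, hij, hjk, h⟩ := exists_minor_ne_zero M
  have hpos := lt_of_le_of_ne (hN i j k hij hjk) h.symm
  obtain ⟨a, b, c, hab, hbc, h0⟩ : ∃ a b c, a < b ∧ b < c ∧
      det3 (cols M a) (cols M b) (cols M c) = 0 := by
    by_contra! hne
    exact hx' ⟨M, rfl, (forall_minor_iff M (fun x => 0 < x)).2 fun a b c hab hbc =>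
      lt_of_le_of_ne (hN a b c hab hbc) (hne a b c hab hbc).symm⟩
  have hcl := mem_closure_negConic hN (sixRel_of_mem_VReal hV) ⟨i, j, k, hij, hjk, hpos⟩
    (Or.inl ⟨hab, hbc⟩) h0
  -- Nearby configurations keep this minor positive, so a negative minor elsewhere excludes every
  -- nonnegative representative.
  have hopen : IsOpen {w : Fin n → Fin 3 → ℝ | 0 < det3 (w i) (w j) (w k)} :=
    isOpen_lt continuous_const
      (continuous_det3 (continuous_apply i) (continuous_apply j) (continuous_apply k))
  have hcl' := hopen.inter_closure ⟨(hpos : cols M ∈ {w | 0 < det3 (w i) (w j) (w k)}), hcl⟩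
  refine mk_mem_closure hcl' fun N hN => ⟨mk_mem_VReal_of_mem_closure hN.2.1, fun hNN => ?_⟩
  obtain ⟨hNpos, -, p, q, r, hpqr, hneg⟩ := hN
  have hTN : TNonneg (cols N) := by
    refine (forall_minor_iff N (fun x => 0 ≤ x)).1 fun I => ?_
    have := minor_mul_nonneg_of_mem_GrNonneg hNN I (triple hij hjk)
    rw [minor_triple] at this
    exact nonneg_of_mul_nonneg_left this hNpos
  exact absurd (hTN.cyc hpqr) (not_le.2 hneg)

theorem interiorIn_VNonneg : interiorIn (VReal 3 n) (VNonneg 3 n) = VReal 3 n ∩ GrPos 3 n := by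
  ext x
  constructor
  · rintro ⟨⟨y, hy⟩, hint, rfl⟩
    refine ⟨hy, ?_⟩
    by_contra hpos
    obtain ⟨U, hU, hUo, hyU⟩ := mem_interior.1 hint
    obtain ⟨W, hW, rfl⟩ := isOpen_induced_iff.1 hUo
    have hyN : y ∈ VNonneg 3 n := hU hyU
    obtain ⟨z, hzW, hzV, hzN⟩ := mem_closure_iff.1 (mem_closure_diff hyN hpos) W hW hyU
    exact hzN (hU (show (⟨z, hzV⟩ : VReal 3 n) ∈ Subtype.val ⁻¹' W from hzW)).2
  · rintro ⟨hV, hpos⟩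
    refine ⟨⟨x, hV⟩, mem_interior.2 ⟨Subtype.val ⁻¹' GrPos 3 n, ?_,
      isOpen_GrPos.preimage continuous_subtype_val, hpos⟩, rfl⟩
    rintro ⟨y, hy⟩ hyp
    exact ⟨hy, GrPos_subset_GrNonneg hyp⟩

end

end ABCT

theorem theorem5p12 (n : ℕ) :
    ABCT.boundaryIn (ABCT.VReal 3 n) (ABCT.VNonneg 3 n) =
        (ABCT.GrNonneg 3 n \ ABCT.GrPos 3 n) ∩ ABCT.VReal 3 n ∧
      ABCT.interiorIn (ABCT.VReal 3 n) (ABCT.VNonneg 3 n) =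
        ABCT.VReal 3 n ∩ ABCT.GrPos 3 n ∧
      closure (ABCT.VReal 3 n ∩ ABCT.GrPos 3 n) = ABCT.VNonneg 3 n := by
  refine ⟨?_, ABCT.interiorIn_VNonneg, ?_⟩
  · rw [ABCT.boundaryIn, ABCT.interiorIn_VNonneg]
    ext x
    simp only [ABCT.VNonneg, Set.mem_sdiff, Set.mem_inter_iff]
    tauto
  · refine Set.Subset.antisymm (closure_minimal ?_ ?_) ABCT.VNonneg_subset_closure
    · exact fun x hx => ⟨hx.1, ABCT.GrPos_subset_GrNonneg hx.2⟩
    · exact ABCT.isClosed_VReal.inter ABCT.isClosed_GrNonneg
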